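/- Let $n\ge 1$, let $\lambda\in\mathbb{C}$ with $|\lambda|>1$, and let $\varphi\in \mathrm{Diff}^\infty([0,\infty))$ be tangent to the identity to infinite order at $0$ (all derivatives of $\varphi(x)-x$ vanish at $0$) with $\varphi(x)>x$ for $x>0$. Put $G=\lambda I_n$, let $\tilde R=(\mathbb{C}^n\times[0,\infty))\setminus\{(O,0)\}$, foliated by the slices $\{x=\mathrm{const}\}$ with their standard complex structure, let $T(z,x)=(\lambda z,\varphi(x))$, and let $R=\tilde R/T^{\mathbb{Z}}$ with the induced foliation and leafwise complex structure. Its boundary leaf is $H=(\mathbb{C}^n\setminus\{O\})/G^{\mathbb{Z}}$, embedded by $[z]\mapsto[(z,0)]$. Let $\mathrm{Aut}\,R$ be the group of diffeomorphisms of $R$ that preserve the foliation and are biholomorphic between leaves, $\mathrm{Aut}\,H$ the group of holomorphic automorphisms of $H$, and $\mathrm{Aut}(R,H)\subset\mathrm{Aut}\,R$ the subgroup of elements that restrict to the identity of $H$. Let $Z_\varphi$ be the centralizer of $\varphi$ in $\mathrm{Diff}^\infty([0,\infty))$, and let $\mathcal{Z}_{\varphi,\lambda}$ be the vector space of smooth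 functions $\beta:(0,\infty)\to\mathbb{C}$ with $\beta(\varphi(x))=\lambda\beta(x)$ for all $x>0$; such a $\beta$ is extended by $\beta(0)=0$. Then: 1. Restriction to the boundary is a well-defined homomorphism $r_H:\mathrm{Aut}\,R\to\mathrm{Aut}\,H$ with kernel $\mathrm{Aut}(R,H)$. If $n\ge2$, then $r_H$ is surjective, so that $1\to\mathrm{Aut}(R,H)\to\mathrm{Aut}\,R\to\mathrm{Aut}\,H\to1$ is exact. 2. If $n\ge2$, then $\mathrm{Aut}\,H\cong GL(n,\mathbb{C})/\langle\lambda I_n\rangle$, the class of $A\in GL(n,\mathbb{C})$ acting on $H$ by $[z]\mapsto[Az]$. 3. $\mathrm{Aut}(R,H)\cong(\mathcal{Z}_{\varphi,\lambda})^n\rtimes Z_\varphi$, where $\beta=(\beta_1,\dots,\beta_n)\in(\mathcal{Z}_{\varphi,\lambda})^n$ corresponds to $[(z,x)]\mapsto[(z+\beta(x),x)]$ and $\eta\in Z_\varphi$ corresponds to $[(z,x)]\mapsto[(z,\eta(x))]$. Here $\eta$ acts on $(\mathcal{Z}_{\varphi,\lambda})^n$ by precomposition, $\eta^{-1}\cdot\beta\cdot\eta=(\beta_1\circ\eta,\dots,\beta_n\circ\eta)$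 in the semidirect product. -/

import Mathlib

open scoped NNReal Topology ContDiff Matrix

namespace LCReeb

noncomputable section

/-! ### Diffeomorphisms of the half line `[0,∞)` -/

/-- A self-map of `[0,∞)` regarded as a function of a real variable (only its values on
`[0,∞)` matter). -/
def onReal (f : ℝ≥0 → ℝ≥0) (x : ℝ) : ℝ := (f x.toNNReal : ℝ)

/-- Smoothness of a self-map of `[0,∞)`, up to and including the boundary point `0`. -/
def SmoothHalf (f : ℝ≥0 → ℝ≥0) : Prop := ContDiffOn ℝ ∞ (onReal f) (Set.Ici 0)

theorem SmoothHalf.comp {f g : ℝ≥0 → ℝ≥0} (hg : SmoothHalf g) (hf : SmoothHalf f) :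
    SmoothHalf (g ∘ f) := by
  have h := ContDiffOn.comp (t := Set.Ici (0 : ℝ)) hg hf
    (fun x _ => (NNReal.coe_nonneg (f x.toNNReal)))
  refine h.congr (fun x _ => ?_)
  simp [onReal]

/-- The group `Diff^∞([0,∞))`, with composition as multiplication. -/
def DiffHalf : Subgroup (Equiv.Perm ℝ≥0) where
  carrier := {f | SmoothHalf f ∧ SmoothHalf f.symm}
  one_mem' := by
    have h : SmoothHalf (fun x => x) :=
      contDiffOn_id.congr (fun x hx => Real.coe_toNNReal x hx)
    exact ⟨h, h⟩
  mul_mem' := fun ha hb => ⟨ha.1.comp hb.1, hb.2.comp ha.2⟩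
  inv_mem' := fun ha => ⟨ha.2, ha.1⟩

theorem SmoothHalf.continuous {f : ℝ≥0 → ℝ≥0} (hf : SmoothHalf f) : Continuous f := by
  have h1 : ContinuousOn (onReal f) (Set.Ici 0) := ContDiffOn.continuousOn hf
  have h2 : Continuous fun x : ℝ≥0 => onReal f x :=
    h1.comp_continuous NNReal.continuous_coe (fun x => x.2)
  have h3 : Continuous fun x : ℝ≥0 => ((f x : ℝ≥0) : ℝ) := by simpa [onReal] using h2
  exact NNReal.isEmbedding_coe.continuous_iff.mpr h3

theorem map_zero_half (η : DiffHalf) : η.1 0 = 0 := by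
  have hc := η.2.1.continuous
  obtain ⟨y, hy⟩ := η.1.surjective 0
  obtain ⟨w, hw⟩ := η.1.surjective (η.1 0 + 1)
  rcases hc.strictMono_of_inj η.1.injective with h | h
  · have h1 : η.1 0 ≤ η.1 y := h.monotone zero_le
    rw [hy] at h1
    exact le_antisymm h1 zero_le
  · have h1 := h.antitone (zero_le : (0 : ℝ≥0) ≤ w)
    rw [hw] at h1
    exact absurd h1 (by simp)

theorem map_pos_half (η : DiffHalf) {x : ℝ≥0} (hx : 0 < x) : 0 < η.1 x := by
  rw [pos_iff_ne_zero] at hx ⊢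
  intro h
  exact hx (η.1.injective (h.trans (map_zero_half η).symm))

/-- `φ` is tangent to the identity to infinite order at `0`: all derivatives of `φ(x) - x`
vanish at `0`. -/
def InfTangentToId (φ : DiffHalf) : Prop :=
  ∀ k : ℕ, iteratedDerivWithin k (fun x => onReal φ.1 x - x) (Set.Ici 0) 0 = 0

/-- The centralizer `Z_φ` of `φ` in `Diff^∞([0,∞))`. -/
abbrev Zc (φ : DiffHalf) : Subgroup DiffHalf := Subgroup.centralizer {φ}

/-! ### The space of solutions of `β(φ(x)) = λ β(x)` on `(0,∞)` -/

/-- The open half line `(0,∞)`. -/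
abbrev PosHalf : Type := {x : ℝ≥0 // 0 < x}

/-- The restriction of `η ∈ Diff^∞([0,∞))` to `(0,∞)`. -/
def posMap (η : DiffHalf) (x : PosHalf) : PosHalf := ⟨η.1 x.1, map_pos_half η x.2⟩

/-- Extension by `0` at the origin of a function on `(0,∞)`. -/
def extZero (β : PosHalf → ℂ) (x : ℝ≥0) : ℂ := if h : 0 < x then β ⟨x, h⟩ else 0

/-- Smoothness of a function on the open half line `(0,∞)`. -/
def SmoothPos (β : PosHalf → ℂ) : Prop :=
  ContDiffOn ℝ ∞ (fun x : ℝ => extZero β x.toNNReal) (Set.Ioi 0)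

theorem extZero_pos (β : PosHalf → ℂ) (x : PosHalf) : extZero β x.1 = β x := by
  simp [extZero, x.2]

theorem SmoothPos.comp {β : PosHalf → ℂ} (hβ : SmoothPos β) (η : DiffHalf) :
    SmoothPos (β ∘ posMap η) := by
  have h1 : ContDiffOn ℝ ∞ (onReal η.1) (Set.Ioi 0) :=
    ContDiffOn.mono η.2.1 Set.Ioi_subset_Ici_self
  have h := ContDiffOn.comp (t := Set.Ioi (0 : ℝ)) hβ h1 (fun x hx => by
    have : 0 < η.1 x.toNNReal := map_pos_half η (by simpa using hx)
    simpa [onReal] using this)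
  refine h.congr (fun x hx => ?_)
  have hx' : 0 < x.toNNReal := by simpa using hx
  have hy : 0 < η.1 x.toNNReal := map_pos_half η hx'
  simp [onReal, extZero, posMap, hy, show (0 : ℝ) < x from hx]

/-- The vector space `𝒵_{φ,λ}` of smooth functions `β : (0,∞) → ℂ` with
`β(φ(x)) = λ β(x)`. -/
def ZSol (φ : DiffHalf) (l : ℂˣ) : Submodule ℂ (PosHalf → ℂ) where
  carrier := {β | SmoothPos β ∧ ∀ x, β (posMap φ x) = l * β x}
  zero_mem' := by
    refine ⟨contDiffOn_const (c := (0 : ℂ)) |>.congr (fun x _ => ?_), fun x => by simp⟩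
    simp [extZero]
  add_mem' := fun {a b} ha hb => by
    refine ⟨(ContDiffOn.add ha.1 hb.1).congr (fun x hx => ?_), fun x => ?_⟩
    · have : (0 : ℝ) < x := hx
      simp [extZero, this]
    · simp [ha.2 x, hb.2 x, mul_add]
  smul_mem' := fun c a ha => by
    refine ⟨(ContDiffOn.const_smul c ha.1).congr (fun x hx => ?_), fun x => ?_⟩
    · have : (0 : ℝ) < x := hx
      simp [extZero, this]
    · simp [ha.2 x, mul_left_comm]

/-- `β ↦ β ∘ η` on `𝒵_{φ,λ}`, for `η` commuting with `φ`. -/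
def precomp {φ : DiffHalf} {l : ℂˣ} (η : Zc φ) (β : ZSol φ l) : ZSol φ l :=
  ⟨β.1 ∘ posMap η.1, β.2.1.comp η.1, fun x => by
    have hc : posMap η.1 (posMap φ x) = posMap φ (posMap η.1 x) := by
      have h := (Subgroup.mem_centralizer_singleton_iff.mp η.2)
      have h' := congrArg (fun g : DiffHalf => g.1 x.1) h
      exact Subtype.ext (by exact h')
    show β.1 (posMap η.1 (posMap φ x)) = l * β.1 (posMap η.1 x)
    rw [hc]
    exact β.2.2 _⟩

/-- The additive group `(𝒵_{φ,λ})ⁿ`, written multiplicatively. -/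
abbrev ZPow (n : ℕ) (φ : DiffHalf) (l : ℂˣ) : Type := Multiplicative (Fin n → ZSol φ l)

/-- The action of `Z_φ` on `(𝒵_{φ,λ})ⁿ` by precomposition.  Since `β ↦ β ∘ η` is a right
action, the corresponding homomorphism into the automorphism group sends `η` to
`(β₁,…,βₙ) ↦ (β₁ ∘ η⁻¹,…,βₙ ∘ η⁻¹)`; thus `η⁻¹ β η = β ∘ η` in the semidirect product. -/
def precompHom (n : ℕ) (φ : DiffHalf) (l : ℂˣ) : Zc φ →* MulAut (ZPow n φ l) where
  toFun η :=
    { toFun := fun β => Multiplicative.ofAdd fun i => precomp η⁻¹ (β.toAdd i)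
      invFun := fun β => Multiplicative.ofAdd fun i => precomp η (β.toAdd i)
      left_inv := fun β => by
        apply Multiplicative.toAdd.injective
        funext i
        apply Subtype.ext
        funext x
        simp [precomp, posMap]
      right_inv := fun β => by
        apply Multiplicative.toAdd.injective
        funext i
        apply Subtype.ext
        funext x
        simp [precomp, posMap]
      map_mul' := fun β γ => rfl }
  map_one' := by
    ext β
    rfl
  map_mul' η ζ := by
    refine MulEquiv.ext fun β => ?_
    apply Multiplicative.toAdd.injective
    funext i
    apply Subtype.ext
    funext x
    simp [precomp, posMap]

/-! ### The Hopf manifold `H` and the Reeb component `R` -/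

/-- `ℂⁿ \ {O}`. -/
abbrev Htilde (n : ℕ) : Type := {z : Fin n → ℂ // z ≠ 0}

/-- `ℂⁿ × [0,∞) \ {(O,0)}`. -/
abbrev Rtilde (n : ℕ) : Type := {p : (Fin n → ℂ) × ℝ≥0 // p ≠ 0}

/-- The inclusion of `ℂⁿ × [0,∞) \ {(O,0)}` into the vector space `ℂⁿ × ℝ`. -/
def incl {n : ℕ} (p : Rtilde n) : (Fin n → ℂ) × ℝ := (p.1.1, (p.1.2 : ℝ))

/-- `G(z) = λ z` on `ℂⁿ \ {O}`. -/
def G (n : ℕ) (l : ℂˣ) : Equiv.Perm (Htilde n) where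
  toFun z := ⟨l • z.1, fun h => z.2 ((smul_eq_zero_iff_eq l).mp h)⟩
  invFun z := ⟨l⁻¹ • z.1, fun h => z.2 ((smul_eq_zero_iff_eq l⁻¹).mp h)⟩
  left_inv z := by simp
  right_inv z := by simp

theorem T_ne_zero {n : ℕ} (l : ℂˣ) (φ : DiffHalf) (p : Rtilde n) :
    ((l • p.1.1, φ.1 p.1.2) : (Fin n → ℂ) × ℝ≥0) ≠ 0 := by
  intro h
  have h1 : l • p.1.1 = 0 := congrArg Prod.fst h
  have h2 : φ.1 p.1.2 = 0 := congrArg Prod.snd h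
  exact p.2 (Prod.ext ((smul_eq_zero_iff_eq l).mp h1)
    (φ.1.injective (h2.trans (map_zero_half φ).symm)))

/-- `T(z,x) = (λ z, φ(x))` on `ℂⁿ × [0,∞) \ {(O,0)}`. -/
def T (n : ℕ) (l : ℂˣ) (φ : DiffHalf) : Equiv.Perm (Rtilde n) where
  toFun p := ⟨(l • p.1.1, φ.1 p.1.2), T_ne_zero l φ p⟩
  invFun p := ⟨(l⁻¹ • p.1.1, φ⁻¹.1 p.1.2), T_ne_zero l⁻¹ φ⁻¹ p⟩
  left_inv p := by simp
  right_inv p := by simp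

/-- The Hopf manifold `H = (ℂⁿ \ {O}) / G^ℤ`. -/
def H (n : ℕ) (l : ℂˣ) : Type :=
  Quotient (MulAction.orbitRel (Subgroup.zpowers (G n l)) (Htilde n))

/-- The Reeb component `R = (ℂⁿ × [0,∞) \ {(O,0)}) / T^ℤ`. -/
def R (n : ℕ) (l : ℂˣ) (φ : DiffHalf) : Type :=
  Quotient (MulAction.orbitRel (Subgroup.zpowers (T n l φ)) (Rtilde n))

/-- The covering projection onto `H`. -/
def projH {n : ℕ} {l : ℂˣ} (z : Htilde n) : H n l := Quotient.mk _ z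

/-- The covering projection onto `R`. -/
def projR {n : ℕ} {l : ℂˣ} {φ : DiffHalf} (p : Rtilde n) : R n l φ := Quotient.mk _ p

/-- The inclusion of `(ℂⁿ \ {O}) × {0}` as the boundary of `ℂⁿ × [0,∞) \ {(O,0)}`. -/
def bdryTilde {n : ℕ} (z : Htilde n) : Rtilde n :=
  ⟨(z.1, 0), fun h => z.2 (congrArg Prod.fst h)⟩

theorem bdryTilde_zpow {n : ℕ} (l : ℂˣ) (φ : DiffHalf) (k : ℤ) (z : Htilde n) :
    bdryTilde ((G n l ^ k) z) = (T n l φ ^ k) (bdryTilde z) := by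
  have h1 : ∀ z, bdryTilde (G n l z) = T n l φ (bdryTilde z) := fun z =>
    Subtype.ext (Prod.ext rfl (map_zero_half φ).symm)
  have h2 : ∀ z, bdryTilde ((G n l)⁻¹ z) = (T n l φ)⁻¹ (bdryTilde z) := fun z => by
    rw [Equiv.Perm.eq_inv_iff_eq, ← h1]
    simp
  induction k using Int.induction_on generalizing z with
  | zero => rfl
  | succ k ih => rw [zpow_add_one, zpow_add_one, Equiv.Perm.mul_apply, ih, h1]; rfl
  | pred k ih => rw [zpow_sub_one, zpow_sub_one, Equiv.Perm.mul_apply, ih, h2]; rfl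

/-- The inclusion of `H` as the boundary leaf of `R`, `[z] ↦ [(z,0)]`. -/
def bdry {n : ℕ} {l : ℂˣ} {φ : DiffHalf} : H n l → R n l φ :=
  Quotient.map bdryTilde (by
    rintro a b ⟨⟨g, k, rfl⟩, rfl⟩
    exact ⟨⟨T n l φ ^ k, k, rfl⟩, (bdryTilde_zpow l φ k b).symm⟩)

/-! ### Automorphisms of the Hopf manifold -/

/-- Holomorphic self-maps of `H`.  Since `H` carries the quotient complex structure, for which
the projection from `ℂⁿ \ {O}` is a local biholomorphism, these are the maps that are given by
holomorphic maps in the coordinates of `ℂⁿ \ {O}` near every point. -/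
def IsHolo {n : ℕ} {l : ℂˣ} (f : H n l → H n l) : Prop :=
  ∀ p : Htilde n, ∃ (U : Set (Fin n → ℂ)) (F : (Fin n → ℂ) → (Fin n → ℂ)),
    IsOpen U ∧ p.1 ∈ U ∧ DifferentiableOn ℂ F U ∧
    ∀ q : Htilde n, q.1 ∈ U → ∃ q' : Htilde n, q'.1 = F q.1 ∧ f (projH q) = projH q'

theorem IsHolo.id {n : ℕ} {l : ℂˣ} : IsHolo (fun x : H n l => x) := fun _ =>
  ⟨Set.univ, fun z => z, isOpen_univ, trivial, differentiableOn_id, fun q _ => ⟨q, rfl, rfl⟩⟩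

theorem IsHolo.comp {n : ℕ} {l : ℂˣ} {g f : H n l → H n l} (hg : IsHolo g) (hf : IsHolo f) :
    IsHolo (g ∘ f) := by
  intro p
  obtain ⟨U, F, hU, hp, hF, hq⟩ := hf p
  obtain ⟨p', hp', -⟩ := hq p hp
  obtain ⟨V, F', hV, hpV, hF', hq'⟩ := hg p'
  refine ⟨U ∩ F ⁻¹' V, F' ∘ F, hF.continuousOn.isOpen_inter_preimage hU hV,
    ⟨hp, ?_⟩, ?_, ?_⟩
  · show F p.1 ∈ V
    rw [← hp']
    exact hpV
  · exact hF'.comp (hF.mono Set.inter_subset_left) (fun x hx => hx.2)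
  · rintro q ⟨hqU, hqV⟩
    obtain ⟨r, hr, hfr⟩ := hq q hqU
    obtain ⟨s, hs, hgs⟩ := hq' r (by rw [hr]; exact hqV)
    refine ⟨s, by simp [hs, hr], ?_⟩
    simp [hfr, hgs]

/-- `Aut H`: the group of holomorphic automorphisms of `H`. -/
def AutH (n : ℕ) (l : ℂˣ) : Subgroup (Equiv.Perm (H n l)) where
  carrier := {f | IsHolo f ∧ IsHolo f.symm}
  one_mem' := ⟨IsHolo.id, IsHolo.id⟩
  mul_mem' := fun ha hb => ⟨ha.1.comp hb.1, hb.2.comp ha.2⟩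
  inv_mem' := fun ha => ⟨ha.2, ha.1⟩

/-! ### Leafwise holomorphic smooth automorphisms of the Reeb component -/

/-- The leaf of `R` that is the image of the leaf `{x = c}` of `ℂⁿ × [0,∞) \ {(O,0)}`. -/
def leaf {n : ℕ} {l : ℂˣ} {φ : DiffHalf} (c : ℝ≥0) : Set (R n l φ) :=
  projR '' {p : Rtilde n | p.1.2 = c}

/-- Smooth self-maps of `R` that map leaves into leaves, holomorphically.

`R` carries the quotient structure, for which the projection from `ℂⁿ × [0,∞) \ {(O,0)}` is a
local isomorphism of foliated manifolds with leafwise complex structure.  So near every point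
the map is given, in the coordinates `(z,x)`, by a map `F` which is smooth (up to the boundary
`x = 0`); along each leaf, i.e. for each fixed `x`, the transverse coordinate of `F(z,x)` is
locally constant in `z`, and the `ℂⁿ`-coordinate of `F(z,x)` is holomorphic in `z`. -/
structure IsLeafHolo {n : ℕ} {l : ℂˣ} {φ : DiffHalf} (f : R n l φ → R n l φ) : Prop where
  map_leaf : ∀ c, ∃ c', f '' leaf c ⊆ leaf c'
  exists_local : ∀ p : Rtilde n, ∃ (U : Set ((Fin n → ℂ) × ℝ))
    (F : (Fin n → ℂ) × ℝ → (Fin n → ℂ) × ℝ),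
    IsOpen U ∧ incl p ∈ U ∧ ContDiffOn ℝ ∞ F (U ∩ Set.range (incl (n := n))) ∧
    ∀ q : Rtilde n, incl q ∈ U →
      (∃ q' : Rtilde n, incl q' = F (incl q) ∧ f (projR q) = projR q') ∧
      (∀ᶠ w in 𝓝 q.1.1, (F (w, (q.1.2 : ℝ))).2 = (F (incl q)).2) ∧
      DifferentiableAt ℂ (fun w => (F (w, (q.1.2 : ℝ))).1) q.1.1

theorem IsLeafHolo.id {n : ℕ} {l : ℂˣ} {φ : DiffHalf} : IsLeafHolo (fun x : R n l φ => x) where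
  map_leaf c := ⟨c, by simp⟩
  exists_local _ := ⟨Set.univ, fun z => z, isOpen_univ, trivial, contDiffOn_id, fun q _ =>
    ⟨⟨q, rfl, rfl⟩, Filter.Eventually.of_forall fun _ => rfl, differentiableAt_id⟩⟩

theorem IsLeafHolo.comp {n : ℕ} {l : ℂˣ} {φ : DiffHalf} {g f : R n l φ → R n l φ}
    (hg : IsLeafHolo g) (hf : IsLeafHolo f) : IsLeafHolo (g ∘ f) where
  map_leaf c := by
    obtain ⟨c', hc'⟩ := hf.map_leaf c
    obtain ⟨c'', hc''⟩ := hg.map_leaf c'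
    refine ⟨c'', ?_⟩
    rw [Set.image_comp]
    exact (Set.image_mono hc').trans hc''
  exists_local p := by
    obtain ⟨U, F, hU, hp, hF, hq⟩ := hf.exists_local p
    obtain ⟨⟨p', hp', -⟩, -⟩ := hq p hp
    obtain ⟨V, F', hV, hpV, hF', hq'⟩ := hg.exists_local p'
    obtain ⟨O, hO, hOe⟩ := (_root_.continuousOn_iff'.mp hF.continuousOn) V hV
    have hmem : ∀ q : Rtilde n, incl q ∈ O ∩ U → F (incl q) ∈ V := fun q hqq =>
      ((Set.ext_iff.mp hOe (incl q)).mpr ⟨hqq.1, hqq.2, q, rfl⟩).1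
    refine ⟨O ∩ U, F' ∘ F, hO.inter hU, ⟨?_, hp⟩, ?_, ?_⟩
    · exact ((Set.ext_iff.mp hOe (incl p)).mp ⟨by
        show F (incl p) ∈ V
        rw [← hp']
        exact hpV, hp, p, rfl⟩).1
    · refine hF'.comp (hF.mono ?_) ?_
      · exact fun x hx => ⟨hx.1.2, hx.2⟩
      · rintro x ⟨hx, q, rfl⟩
        obtain ⟨⟨r, hr, -⟩, -⟩ := hq q hx.2
        exact ⟨hmem q hx, r, hr⟩
    · intro q hqq
      obtain ⟨⟨r, hr, hfr⟩, hpl, hd⟩ := hq q hqq.2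
      obtain ⟨⟨s, hs, hgs⟩, hpl', hd'⟩ := hq' r (by rw [hr]; exact hmem q hqq)
      have hr1 : r.1.1 = (F (q.1.1, (q.1.2 : ℝ))).1 := congrArg Prod.fst hr
      have hr2 : (r.1.2 : ℝ) = (F (incl q)).2 := congrArg Prod.snd hr
      have hev : ∀ᶠ w in 𝓝 q.1.1,
          F (w, (q.1.2 : ℝ)) = ((F (w, (q.1.2 : ℝ))).1, (r.1.2 : ℝ)) := by
        filter_upwards [hpl] with w hw
        exact Prod.ext rfl (hw.trans hr2.symm)
      refine ⟨⟨s, ?_, ?_⟩, ?_, ?_⟩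
      · simp [hs, hr]
      · simp [hfr, hgs]
      · have ht : Filter.Tendsto (fun w => (F (w, (q.1.2 : ℝ))).1) (𝓝 q.1.1) (𝓝 r.1.1) := by
          rw [hr1]
          exact hd.continuousAt
        filter_upwards [hev, ht.eventually hpl'] with w hw1 hw2
        show (F' (F (w, (q.1.2 : ℝ)))).2 = (F' (F (incl q))).2
        rw [hw1, hw2, hr]
      · rw [hr1] at hd'
        refine (hd'.comp q.1.1 hd).congr_of_eventuallyEq ?_
        filter_upwards [hev] with w hw
        show (F' (F (w, (q.1.2 : ℝ)))).1 = (F' ((F (w, (q.1.2 : ℝ))).1, (r.1.2 : ℝ))).1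
        rw [← hw]

/-- `Aut R`: the group of leafwise holomorphic smooth automorphisms of `R`, i.e. of the
bijections of `R` which, together with their inverses, are smooth, map leaves into leaves and
are holomorphic along the leaves. -/
def AutR (n : ℕ) (l : ℂˣ) (φ : DiffHalf) : Subgroup (Equiv.Perm (R n l φ)) where
  carrier := {f | IsLeafHolo f ∧ IsLeafHolo f.symm}
  one_mem' := ⟨IsLeafHolo.id, IsLeafHolo.id⟩
  mul_mem' := fun ha hb => ⟨ha.1.comp hb.1, hb.2.comp ha.2⟩
  inv_mem' := fun ha => ⟨ha.2, ha.1⟩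

/-- `Aut(R,H)`: the elements of `Aut R` that restrict to the identity of the boundary `H`. -/
def AutRH (n : ℕ) (l : ℂˣ) (φ : DiffHalf) : Subgroup (AutR n l φ) where
  carrier := {f | ∀ h : H n l, f.1 (bdry h) = bdry h}
  one_mem' := fun _ => rfl
  mul_mem' := fun {a b} ha hb h => by
    show a.1 (b.1 (bdry h)) = bdry h
    rw [hb h, ha h]
  inv_mem' := fun {a} ha h => by
    show a.1.symm (bdry h) = bdry h
    rw [Equiv.symm_apply_eq, ha h]

/-- The infinite cyclic group `⟨λ Iₙ⟩` in `GL(n,ℂ)`. -/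
abbrev scalarPowers (n : ℕ) (l : ℂˣ) : Subgroup (GL (Fin n) ℂ) :=
  Subgroup.zpowers (Matrix.GeneralLinearGroup.scalar (Fin n) l)

instance scalarPowers_normal (n : ℕ) (l : ℂˣ) : (scalarPowers n l).Normal where
  conj_mem := by
    rintro a ⟨k, rfl⟩ g
    refine ⟨k, ?_⟩
    have hc : Commute g (Matrix.GeneralLinearGroup.scalar (Fin n) l) := by
      apply Units.ext
      have := Matrix.scalar_commute (l : ℂ) (fun r' => mul_comm _ _) (g : Matrix (Fin n) (Fin n) ℂ)
      exact this.symm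
    have := (hc.zpow_right k).eq
    simp only
    rw [this, mul_inv_cancel_right]

end

end LCReeb

/-! Everything is transported to the coverings and decided by how a lift commutes with the deck
group. Both $G$ and $T$ generate free, properly discontinuous actions (`isWandering_G`,
`isWandering_T`). The covering of $R$ is contractible, so leafwise holomorphic self-maps of $R$
lift. For $n\ge2$, holomorphic self-maps of $H$ lift as well. Two lifts of one map from a connected
space differ by a power of the generator, so a lift $F$ satisfies $F\circ g=g^m\circ F$ for some
integer $m$.

Restriction. A lift carries leaves to leaves. If it moved the leaf $x=0$ to a leaf $x=c>0$, then
$\varphi^m(c)=c$ would force $m=0$ and $F\circ T=F$, against injectivity (`snd_lift_eq_zero`).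

Automorphisms of $H$. For a lift of an automorphism $m=\pm1$, since $m$ is invertible. If $m=-1$,
the function $\|F(z)\|\|z\|$ is $G$-invariant, hence bounded. Then $F$ tends to $0$ along a complex
line missing $O$ and vanishes there by Liouville, which is impossible (`not_comp_G_eq_inv`). If
$m=1$, the function $\|F(z)\|/\|z\|$ is bounded, so $F$ is affine on lines missing $O$, and
homogeneity under $\lambda$ makes it linear (`isLinearMap_extH`). Since linear maps extend to $R$ by
acting on $z$ alone, restriction is surjective.

The kernel of restriction. Such an automorphism has a lift that fixes the boundary pointwise and
commutes with $T$. Write it as $(z,x)\mapsto(f(z,x),\eta(x))$. Commutation gives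
$f(\lambda^kz,x)=\lambda^kf(z,\varphi^{-k}(x))$. As $k\to\infty$ the right side is governed by the
values near $x=0$, where $f(z,0)=z$. Hence $f(\cdot,x)$ grows linearly, is affine, and has linear
part the identity (`fst_apply_toR`). The remaining data are $\eta\in Z_\varphi$ and the translation
$\beta(y)=f(0,\eta^{-1}(y))$, which satisfies $\beta\circ\varphi=\lambda\beta$.

Conversely, every such $\beta$ must extend smoothly by $0$ to $x=0$. The equation
$\beta=\lambda^{-1}\,\beta\circ\varphi$ is a contraction towards $0$. Its derivatives satisfy
equations of the same type with the same leading coefficient at $0$, because $\varphi'(0)=1$. So all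
derivatives tend to $0$ (`flatTo_of_functional_eq`, `contDiff_extZero`). -/

namespace LCReeb

noncomputable section

/-! ### Quotients by infinite cyclic groups of homeomorphisms -/

section ZPowers

variable {E A : Type*} {g : Equiv.Perm E}

theorem mk_eq_mk_iff_zpow {x y : E} :
    (Quotient.mk (MulAction.orbitRel (Subgroup.zpowers g) E) x) = Quotient.mk _ y ↔
      ∃ k : ℤ, (g ^ k) x = y := by
  rw [Quotient.eq, MulAction.orbitRel_apply]
  constructor
  · rintro ⟨⟨_, k, rfl⟩, rfl⟩
    refine ⟨-k, ?_⟩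
    show (g ^ (-k)) ((g ^ k) y) = y
    rw [← Equiv.Perm.mul_apply, ← zpow_add]
    simp
  · rintro ⟨k, rfl⟩
    refine ⟨⟨g ^ (-k), -k, rfl⟩, ?_⟩
    show (g ^ (-k)) ((g ^ k) x) = x
    rw [← Equiv.Perm.mul_apply, ← zpow_add]
    simp

/-- The permutation of the quotient by `⟨g⟩` induced by a permutation commuting with `g`. -/
def quotientPerm (g : Equiv.Perm E) : Subgroup.centralizer {g} →*
    Equiv.Perm (Quotient (MulAction.orbitRel (Subgroup.zpowers g) E)) :=
  MonoidHom.toHomPerm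
    { toFun := fun u => Quotient.map u.1 (by
        intro a b hab
        have h := Quotient.sound (s := MulAction.orbitRel (Subgroup.zpowers g) E) hab
        obtain ⟨k, rfl⟩ := mk_eq_mk_iff_zpow.mp h
        refine Quotient.exact (mk_eq_mk_iff_zpow.mpr ⟨k, ?_⟩)
        have hc : Commute u.1 g := Subgroup.mem_centralizer_singleton_iff.mp u.2
        exact (congrArg (fun p : Equiv.Perm E => p a) (hc.zpow_right k).eq).symm)
      map_one' := by
        funext x
        induction x using Quotient.inductionOn
        rfl
      map_mul' := fun u v => by
        funext x
        induction x using Quotient.inductionOn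
        rfl }

variable [TopologicalSpace E] [TopologicalSpace A]

theorem continuous_perm_zpow (h1 : Continuous g) (h2 : Continuous g.symm) (k : ℤ) :
    Continuous (g ^ k) := by
  induction k using Int.induction_on with
  | zero => exact continuous_id
  | succ k ih => rw [zpow_add_one]; exact ih.comp h1
  | pred k ih => rw [zpow_sub_one]; exact ih.comp h2

/-- The generator of a cyclic group of homeomorphisms that is free and properly discontinuous:
every point has a neighbourhood that is disjoint from its proper forward translates. -/
structure IsWandering (g : Equiv.Perm E) : Prop where
  continuous : Continuous g
  continuous_symm : Continuous g.symm
  exists_nhds : ∀ e, ∃ U ∈ 𝓝 e, ∀ k : ℕ, 0 < k → ∀ x ∈ U, (g ^ k) x ∉ U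

namespace IsWandering

variable (hg : IsWandering g)
include hg

theorem isQuotientCoveringMap :
    IsQuotientCoveringMap (Quotient.mk (MulAction.orbitRel (Subgroup.zpowers g) E))
      (Subgroup.zpowers g) where
  toIsQuotientMap := isQuotientMap_quot_mk
  continuous_const_smul := by
    rintro ⟨_, k, rfl⟩
    exact continuous_perm_zpow hg.continuous hg.continuous_symm k
  apply_eq_iff_mem_orbit := by
    intro x y
    rw [Quotient.eq, MulAction.orbitRel_apply]
  disjoint e := by
    obtain ⟨U, hU, h⟩ := hg.exists_nhds e
    refine ⟨U, hU, ?_⟩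
    rintro ⟨_, k, rfl⟩ ⟨_, ⟨x, hx, rfl⟩, hx'⟩
    change (g ^ k) x ∈ U at hx'
    have hk : k = 0 := by
      rcases lt_trichotomy k 0 with hk | hk | hk
      -- Only forward translates are controlled, so for negative exponents `x` and its translate
      -- exchange roles.
      · obtain ⟨m, rfl⟩ := Int.exists_eq_neg_ofNat hk.le
        refine absurd ?_ (h m (by omega) _ hx')
        rw [← zpow_natCast, ← Equiv.Perm.mul_apply, ← zpow_add]
        simpa using hx
      · exact hk
      · obtain ⟨m, rfl⟩ := Int.eq_ofNat_of_zero_le hk.le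
        exact absurd (by simpa using hx') (h m (by omega) _ hx)
    subst hk
    simp

theorem isCoveringMap :
    IsCoveringMap (Quotient.mk (MulAction.orbitRel (Subgroup.zpowers g) E)) :=
  hg.isQuotientCoveringMap.isCoveringMap

theorem zpow_eq_zero {k : ℤ} {x : E} (h : (g ^ k) x = x) : k = 0 := by
  obtain ⟨U, hU, hd⟩ := hg.exists_nhds x
  have hx := mem_of_mem_nhds hU
  by_contra hk
  have h' : (g ^ k.natAbs) x = x := by
    rcases Int.natAbs_eq k with h0 | h0
    · rw [← zpow_natCast, ← h0, h]
    · have h1 : ((k.natAbs : ℕ) : ℤ) = -k := by omega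
      rw [← zpow_natCast, h1]
      conv_lhs => rw [← h]
      rw [← Equiv.Perm.mul_apply, ← zpow_add]
      simp
  exact hd k.natAbs (by omega) x hx (by rwa [h'])

theorem zpow_injective {k m : ℤ} {x : E} (h : (g ^ k) x = (g ^ m) x) : k = m := by
  have : (g ^ (-m + k)) x = x := by
    rw [zpow_add, Equiv.Perm.mul_apply, h, ← Equiv.Perm.mul_apply, ← zpow_add]
    simp
  have := hg.zpow_eq_zero this
  omega

/-- The power is read off at `a` and persists nearby because the projection is injective near `F a`.
This transfers the regularity of a local coordinate expression `s` to a continuous global lift `F`.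
-/
theorem eventually_eq_zpow {s F : A → E} {a : A} (hs : ContinuousAt s a) (hF : ContinuousAt F a)
    (h : ∀ᶠ x in 𝓝 a, Quotient.mk (MulAction.orbitRel (Subgroup.zpowers g) E) (s x)
      = Quotient.mk _ (F x)) :
    ∃ k : ℤ, ∀ᶠ x in 𝓝 a, (g ^ k) (s x) = F x := by
  obtain ⟨k, hk⟩ := mk_eq_mk_iff_zpow.mp h.self_of_nhds
  refine ⟨k, ?_⟩
  obtain ⟨W, hW, hFW, hinj⟩ := hg.isCoveringMap.isLocalHomeomorph.isLocallyInjective (F a)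
  have h1 : ContinuousAt (fun x => (g ^ k) (s x)) a :=
    (continuous_perm_zpow hg.continuous hg.continuous_symm k).continuousAt.comp hs
  filter_upwards [h, hF (hW.mem_nhds hFW), h1 (hW.mem_nhds (by simpa [hk] using hFW))]
    with x hx hx1 hx2
  refine hinj hx2 hx1 ?_
  rw [← hx]
  exact (mk_eq_mk_iff_zpow.mpr ⟨k, rfl⟩).symm

theorem exists_zpow_eq_of_lifts [PreconnectedSpace A] [Nonempty A] {s F : A → E}
    (hs : Continuous s) (hF : Continuous F)
    (h : ∀ x, Quotient.mk (MulAction.orbitRel (Subgroup.zpowers g) E) (s x)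
      = Quotient.mk _ (F x)) :
    ∃ k : ℤ, ∀ x, (g ^ k) (s x) = F x := by
  obtain ⟨a⟩ := ‹Nonempty A›
  obtain ⟨k, hk⟩ := mk_eq_mk_iff_zpow.mp (h a)
  refine ⟨k, fun x => ?_⟩
  refine congrFun (hg.isCoveringMap.eq_of_comp_eq (g₁ := fun x => (g ^ k) (s x))
    ((continuous_perm_zpow hg.continuous hg.continuous_symm k).comp hs) hF ?_ a hk) x
  funext y
  show Quotient.mk _ ((g ^ k) (s y)) = Quotient.mk _ (F y)
  rw [← h]
  exact (mk_eq_mk_iff_zpow.mpr ⟨k, rfl⟩).symm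

theorem exists_lift [SimplyConnectedSpace A] [LocallyPathConnectedSpace A]
    {f : A → Quotient (MulAction.orbitRel (Subgroup.zpowers g) E)} (hf : Continuous f) :
    ∃ F : A → E, Continuous F ∧ ∀ x, Quotient.mk _ (F x) = f x := by
  have : PathConnectedSpace A := inferInstance
  obtain ⟨a⟩ := this.nonempty
  obtain ⟨e, he⟩ := Quotient.exists_rep (f a)
  obtain ⟨F, ⟨-, hF⟩, -⟩ := hg.isCoveringMap.existsUnique_continuousMap_lifts ⟨f, hf⟩ a e he
  exact ⟨F, F.continuous, fun x => congrFun hF x⟩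

/-- Both `F` and `F ∘ g` lift the same map into the quotient. The exponent `m` records the action of
`f` on the deck group. -/
theorem exists_zpow_comp [PreconnectedSpace E] [Nonempty E]
    {f : Quotient (MulAction.orbitRel (Subgroup.zpowers g) E) →
      Quotient (MulAction.orbitRel (Subgroup.zpowers g) E)} {F : E → E} (hF : Continuous F)
    (hFf : ∀ p, Quotient.mk _ (F p) = f (Quotient.mk _ p)) :
    ∃ m : ℤ, ∀ p, F (g p) = (g ^ m) (F p) := by
  obtain ⟨m, hm⟩ := hg.exists_zpow_eq_of_lifts hF (hF.comp hg.continuous) (fun p => by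
    refine (hFf p).trans (Eq.trans ?_ (hFf (g p)).symm)
    rw [mk_eq_mk_iff_zpow.mpr ⟨1, by rw [zpow_one]⟩])
  exact ⟨m, fun p => (hm p).symm⟩

/-- Since `F' ∘ F` lifts the identity, it is a power of `g`, which can be removed from `F'`. The
other composite is then also a power of `g`; it fixes every point of the image of `F`, so freeness
makes it trivial. -/
theorem exists_inverse_lift [PreconnectedSpace E] [Nonempty E]
    {f : Equiv.Perm (Quotient (MulAction.orbitRel (Subgroup.zpowers g) E))} {F F' : E → E}
    (hF : Continuous F) (hF' : Continuous F') (hFf : ∀ p, Quotient.mk _ (F p) = f (Quotient.mk _ p))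
    (hFf' : ∀ p, Quotient.mk _ (F' p) = f.symm (Quotient.mk _ p)) :
    ∃ k : ℤ, Function.LeftInverse (fun p => (g ^ k) (F' p)) F ∧
      Function.RightInverse (fun p => (g ^ k) (F' p)) F := by
  obtain ⟨k, hk⟩ := hg.exists_zpow_eq_of_lifts continuous_id (hF'.comp hF) (fun p => by
    refine ((hFf' (F p)).trans ?_).symm
    rw [hFf, Equiv.symm_apply_apply]
    rfl)
  have hleft : ∀ p, (g ^ (-k)) (F' (F p)) = p := fun p => by
    rw [← show (g ^ k) p = F' (F p) from hk p, ← Equiv.Perm.mul_apply, ← zpow_add]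
    simp
  have hc : Continuous fun p => (g ^ (-k)) (F' p) :=
    (continuous_perm_zpow hg.continuous hg.continuous_symm (-k)).comp hF'
  obtain ⟨m, hm⟩ := hg.exists_zpow_eq_of_lifts continuous_id (hF.comp hc) (fun p => by
    refine ((hFf _).trans ?_).symm
    rw [← mk_eq_mk_iff_zpow.mpr ⟨-k, rfl⟩, hFf', Equiv.apply_symm_apply]
    rfl)
  obtain ⟨e⟩ := ‹Nonempty E›
  have hm0 : m = 0 := by
    refine hg.zpow_eq_zero (x := F e) ?_
    have h1 := hm (F e)
    simp only [Function.comp, id, hleft] at h1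
    exact h1
  subst hm0
  exact ⟨-k, hleft, fun p => (hm p).symm⟩

end IsWandering

end ZPowers

/-! ### Lifting over a union of two simply connected sets -/

/-- Lifts over `A` and `B` exist separately and differ on the connected intersection by a single
power of `g`. Correcting one of them by that power lets them be glued. -/
theorem IsWandering.exists_lift_union {E V : Type*} [TopologicalSpace E] [TopologicalSpace V]
    {g : Equiv.Perm E} (hg : IsWandering g) {A B : Set V} (hA : IsOpen A) (hB : IsOpen B)
    [SimplyConnectedSpace A] [LocallyPathConnectedSpace A]
    [SimplyConnectedSpace B] [LocallyPathConnectedSpace B] (hAB : IsConnected (A ∩ B))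
    {f : V → Quotient (MulAction.orbitRel (Subgroup.zpowers g) E)} (hf : ContinuousOn f (A ∪ B)) :
    ∃ F : V → E, ContinuousOn F (A ∪ B) ∧ ∀ x ∈ A ∪ B, Quotient.mk _ (F x) = f x := by
  classical
  obtain ⟨a, ha, hfa⟩ := hg.exists_lift (A := A) (f := fun x => f x.1)
    (continuousOn_iff_continuous_domRestrict.mp (hf.mono Set.subset_union_left))
  obtain ⟨b, hb, hfb⟩ := hg.exists_lift (A := B) (f := fun x => f x.1)
    (continuousOn_iff_continuous_domRestrict.mp (hf.mono Set.subset_union_right))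
  have : ConnectedSpace (A ∩ B : Set V) := Subtype.connectedSpace hAB
  obtain ⟨k, hk⟩ := hg.exists_zpow_eq_of_lifts (A := (A ∩ B : Set V))
    (s := fun x => b ⟨x.1, x.2.2⟩) (F := fun x => a ⟨x.1, x.2.1⟩)
    (hb.comp (by fun_prop)) (ha.comp (by fun_prop)) (fun x => by rw [hfa, hfb])
  obtain ⟨x₀, -⟩ := hAB.nonempty
  obtain ⟨y₀, -⟩ := Quotient.exists_rep (f x₀)
  -- The value `y₀` outside `A ∪ B` plays no role.
  let b' : V → E := fun x => if h : x ∈ B then (g ^ k) (b ⟨x, h⟩) else y₀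
  let F : V → E := fun x => if h : x ∈ A then a ⟨x, h⟩ else b' x
  have hFA : ∀ x (h : x ∈ A), F x = a ⟨x, h⟩ := fun x h => dif_pos h
  have hFB : ∀ x (h : x ∈ B), F x = (g ^ k) (b ⟨x, h⟩) := fun x h => by
    by_cases h' : x ∈ A
    · rw [hFA x h']
      exact (hk ⟨x, h', h⟩).symm
    · simp only [F, b', dif_neg h', dif_pos h]
  refine ⟨F, ?_, ?_⟩
  · refine ContinuousOn.union_of_isOpen ?_ ?_ hA hB
    · rw [continuousOn_iff_continuous_domRestrict]
      exact ha.congr fun x => (hFA x.1 x.2).symm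
    · rw [continuousOn_iff_continuous_domRestrict]
      exact ((continuous_perm_zpow hg.continuous hg.continuous_symm k).comp hb).congr
        fun x => (hFB x.1 x.2).symm
  · rintro x (hx | hx)
    · rw [hFA x hx, hfa]
    · rw [hFB x hx, ← hfb ⟨x, hx⟩]
      exact (mk_eq_mk_iff_zpow.mpr ⟨k, rfl⟩).symm

/-! ### Complements of rays -/

section Ray

variable {V : Type*} [NormedAddCommGroup V] [NormedSpace ℝ V]

/-- The complement of the closed ray from the origin in the direction `-v`. -/
def rayCompl (v : V) : Set V := ((fun s : ℝ => s • v) '' Set.Iic 0)ᶜ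

theorem isOpen_rayCompl (v : V) : IsOpen (rayCompl v) :=
  (isClosedMap_smul_left v _ isClosed_Iic).isOpen_compl

/-- If $av+bz=sv$ with $s\le0$ and $b>0$, then $z=b^{-1}(s-a)v$ already lies on the removed ray. -/
theorem starConvex_rayCompl {v : V} (hv : v ≠ 0) : StarConvex ℝ v (rayCompl v) := by
  rintro z hz a b ha hb hab ⟨s, hs, h⟩
  rw [Set.mem_Iic] at hs
  rcases hb.eq_or_lt with rfl | hb
  · obtain rfl : a = 1 := by linarith
    have h1 : (s - 1) • v = 0 := by
      have h' : s • v = (1 : ℝ) • v + (0 : ℝ) • z := h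
      rw [sub_smul, h']
      simp
    rcases smul_eq_zero.mp h1 with h2 | h2
    · linarith
    · exact hv h2
  · refine hz ⟨b⁻¹ * (s - a), ?_, ?_⟩
    · exact mul_nonpos_of_nonneg_of_nonpos (inv_nonneg.mpr hb.le) (by linarith)
    · have h' : s • v = a • v + b • z := h
      show (b⁻¹ * (s - a)) • v = z
      rw [mul_smul, sub_smul, h', add_sub_cancel_left, smul_smul, inv_mul_cancel₀ hb.ne', one_smul]

theorem self_mem_rayCompl {v : V} (hv : v ≠ 0) : v ∈ rayCompl v := by
  rintro ⟨s, hs, h⟩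
  rw [Set.mem_Iic] at hs
  have h1 : (s - 1) • v = 0 := by
    have h' : s • v = v := h
    rw [sub_smul, h']
    simp
  rcases smul_eq_zero.mp h1 with h2 | h2
  · linarith
  · exact hv h2

theorem contractibleSpace_rayCompl {v : V} (hv : v ≠ 0) : ContractibleSpace (rayCompl v) :=
  (starConvex_rayCompl hv).contractibleSpace ⟨v, self_mem_rayCompl hv⟩

theorem mem_rayCompl_union_iff {v : V} (hv : v ≠ 0) (z : V) :
    z ∈ rayCompl v ∪ rayCompl (-v) ↔ z ≠ 0 := by
  constructor
  · rintro (h | h) rfl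
    · exact h ⟨0, by simp, by simp⟩
    · exact h ⟨0, by simp, by simp⟩
  · intro hz
    by_contra hcon
    rw [Set.mem_union, not_or] at hcon
    obtain ⟨⟨s, hs, h1⟩, ⟨t, ht, h2⟩⟩ := And.intro (not_not.mp hcon.1) (not_not.mp hcon.2)
    rw [Set.mem_Iic] at hs ht
    have h3 : (s + t) • v = 0 := by
      have h1' : s • v = z := h1
      have h2' : t • -v = z := h2
      rw [add_smul, h1', ← h2', smul_neg, neg_add_cancel]
    rcases smul_eq_zero.mp h3 with h4 | h4
    · obtain rfl : s = 0 := by linarith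
      exact hz (by simpa using h1.symm)
    · exact hv h4

theorem rayCompl_inter (v : V) :
    rayCompl v ∩ rayCompl (-v) = ((Submodule.span ℝ {v} : Submodule ℝ V) : Set V)ᶜ := by
  rw [rayCompl, rayCompl, ← Set.compl_union, compl_inj_iff]
  ext z
  rw [SetLike.mem_coe, Submodule.mem_span_singleton]
  constructor
  · rintro (⟨s, -, h⟩ | ⟨s, -, h⟩)
    · exact ⟨s, h⟩
    · exact ⟨-s, by simpa using h⟩
  · rintro ⟨s, h⟩
    rcases le_total s 0 with hs | hs
    · exact Or.inl ⟨s, hs, h⟩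
    · exact Or.inr ⟨-s, by simpa using hs, by simpa using h⟩

/-- The two opposite rays together form a real line, whose codimension is at least $2$. -/
theorem isConnected_rayCompl_inter [FiniteDimensional ℝ V] (hV : 3 ≤ Module.finrank ℝ V) (v : V) :
    IsConnected (rayCompl v ∩ rayCompl (-v)) := by
  rw [rayCompl_inter]
  refine isConnected_compl_of_one_lt_codim ?_
  rw [← Module.finrank_eq_rank, ← Nat.cast_one, Nat.cast_lt]
  have h1 := Submodule.finrank_quotient_add_finrank (Submodule.span ℝ {v})
  have h2 : Module.finrank ℝ (Submodule.span ℝ {v}) ≤ 1 := by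
    simpa using finrank_span_le_card (R := ℝ) ({v} : Set V)
  omega

end Ray

/-! ### Connectedness of the coverings of `H` and `R` -/

variable {n : ℕ} {l : ℂˣ} {φ : DiffHalf}

theorem finrank_real_pi_complex : Module.finrank ℝ (Fin n → ℂ) = 2 * n := by
  rw [Module.finrank_pi_fintype]
  simp [mul_comm]

theorem isConnected_compl_zero (hn : 1 ≤ n) (c : Fin n → ℂ) :
    IsConnected ({c}ᶜ : Set (Fin n → ℂ)) := by
  refine isConnected_compl_singleton_of_one_lt_rank ?_ c
  rw [← Module.finrank_eq_rank, ← Nat.cast_one, Nat.cast_lt, finrank_real_pi_complex]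
  omega

theorem connectedSpace_Htilde (hn : 1 ≤ n) : ConnectedSpace (Htilde n) :=
  Subtype.connectedSpace (isConnected_compl_zero hn 0)

instance : LocallyPathConnectedSpace ℝ≥0 :=
  (convex_Ici (0 : ℝ)).locallyPathConnectedSpace

instance : LocallyPathConnectedSpace (Rtilde n) :=
  (isOpen_compl_singleton (x := (0 : (Fin n → ℂ) × ℝ≥0))).locallyPathConnectedSpace

/-- The base point `(O,1)` of `ℂⁿ × [0,∞) \ {(O,0)}`. -/
def basePoint (n : ℕ) : Rtilde n := ⟨(0, 1), fun h => one_ne_zero (congrArg Prod.snd h)⟩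

/-- For $t>0$ the second coordinate $(1-t)x+t$ is positive, so the segment from a point to $(O,1)$
avoids $(O,0)$. -/
theorem contraction_ne_zero (t : unitInterval) (p : Rtilde n) :
    (((1 - t.1) • p.1.1, (Real.toNNReal (1 - t.1)) * p.1.2 + Real.toNNReal t.1) :
      (Fin n → ℂ) × ℝ≥0) ≠ 0 := by
  intro h
  have h1 : (1 - t.1) • p.1.1 = 0 := congrArg Prod.fst h
  have h2 : (Real.toNNReal (1 - t.1)) * p.1.2 + Real.toNNReal t.1 = 0 := congrArg Prod.snd h
  obtain ⟨h3, h4⟩ := add_eq_zero.mp h2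
  have ht : t.1 = 0 := le_antisymm (Real.toNNReal_eq_zero.mp h4) t.2.1
  rw [ht] at h1 h3
  exact p.2 (Prod.ext (by simpa using h1) (by simpa using h3))

instance : ContractibleSpace (Rtilde n) := by
  rw [contractible_iff_id_nullhomotopic]
  refine ⟨basePoint n, ⟨⟨⟨fun q => ⟨_, contraction_ne_zero q.1 q.2⟩, ?_⟩, ?_, ?_⟩⟩⟩
  · fun_prop
  · intro p
    apply Subtype.ext
    simp
  · intro p
    apply Subtype.ext
    simp [basePoint]

/-- The space $\mathbb{C}^n\setminus\{O\}$ is the union of two contractible complements of opposite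
rays. Their intersection is connected because $2n\ge3$. This takes the place of simple connectedness
and is where $n\ge2$ enters the lifting. -/
theorem IsWandering.exists_lift_Htilde {E : Type*} [TopologicalSpace E]
    {g : Equiv.Perm E} (hg : IsWandering g) (hn : 2 ≤ n)
    {f : Htilde n → Quotient (MulAction.orbitRel (Subgroup.zpowers g) E)} (hf : Continuous f) :
    ∃ F : Htilde n → E, Continuous F ∧ ∀ x, Quotient.mk _ (F x) = f x := by
  classical
  obtain ⟨v, hv⟩ := (isConnected_compl_zero (n := n) (by omega) 0).nonempty
  have hv' : -v ≠ 0 := neg_ne_zero.mpr hv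
  have := contractibleSpace_rayCompl hv
  have := contractibleSpace_rayCompl hv'
  have := (isOpen_rayCompl v).locallyPathConnectedSpace
  have := (isOpen_rayCompl (-v)).locallyPathConnectedSpace
  have hu : rayCompl v ∪ rayCompl (-v) = {z | z ≠ 0} := by
    ext z
    exact mem_rayCompl_union_iff hv z
  obtain ⟨F, hF, h⟩ := hg.exists_lift_union (isOpen_rayCompl v) (isOpen_rayCompl (-v))
    (isConnected_rayCompl_inter (by rw [finrank_real_pi_complex]; omega) v)
    (f := fun z => if h : z ≠ 0 then f ⟨z, h⟩ else f ⟨v, hv⟩) (by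
      rw [hu, continuousOn_iff_continuous_domRestrict]
      refine hf.congr fun x => ?_
      rw [Set.domRestrict_apply, dif_pos (show x.1 ≠ 0 from x.2)])
  rw [hu] at hF h
  refine ⟨fun x => F x.1, continuousOn_iff_continuous_domRestrict.mp hF, fun x => ?_⟩
  rw [h x.1 x.2]
  exact dif_pos x.2

/-! ### The deck transformations -/

theorem strictMono_half (η : DiffHalf) : StrictMono η.1 := by
  refine (η.2.1.continuous.strictMono_of_inj η.1.injective).resolve_right fun h => ?_
  have := h (zero_lt_one (α := ℝ≥0))
  rw [map_zero_half] at this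
  exact not_lt_zero this

theorem norm_units_smul (l : ℂˣ) (z : Fin n → ℂ) : ‖l • z‖ = ‖(l : ℂ)‖ * ‖z‖ := by
  rw [Units.smul_def, norm_smul]

theorem G_pow_apply (k : ℕ) (z : Htilde n) : ((G n l ^ k) z).1 = l ^ k • z.1 := by
  induction k with
  | zero => simp
  | succ k ih =>
    rw [pow_succ', Equiv.Perm.mul_apply, pow_succ', mul_smul, ← ih]
    rfl

theorem T_pow_apply (k : ℕ) (p : Rtilde n) :
    ((T n l φ ^ k) p).1 = (l ^ k • p.1.1, (φ ^ k).1 p.1.2) := by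
  induction k with
  | zero => simp
  | succ k ih =>
    rw [pow_succ', Equiv.Perm.mul_apply, pow_succ', mul_smul, pow_succ']
    show (l • ((T n l φ ^ k) p).1.1, φ.1 ((T n l φ ^ k) p).1.2) = _
    rw [ih]
    rfl

/-- With $c=\sqrt{|\lambda|}$, the shell between the radii $\|z\|/c$ and $\|z\|c$ has ratio of radii
$|\lambda|$, so multiplication by $\lambda^k$ with $k\ge1$ pushes it off itself. -/
theorem exists_annulus_nhds (hl : 1 < ‖(l : ℂ)‖) {z : Fin n → ℂ} (hz : z ≠ 0) :
    ∃ a b : ℝ, a < ‖z‖ ∧ ‖z‖ < b ∧ ∀ k : ℕ, 0 < k → ∀ w : Fin n → ℂ, a < ‖w‖ →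
      ‖w‖ < b → ¬ ‖l ^ k • w‖ < b := by
  have hz' : 0 < ‖z‖ := norm_pos_iff.mpr hz
  set c := Real.sqrt ‖(l : ℂ)‖ with hc
  have hc1 : 1 < c := by
    rw [hc]
    exact Real.lt_sqrt_of_sq_lt (by simpa using hl)
  have hcc : c * c = ‖(l : ℂ)‖ := Real.mul_self_sqrt (norm_nonneg _)
  refine ⟨‖z‖ / c, ‖z‖ * c, div_lt_self hz' hc1, lt_mul_of_one_lt_right hz' hc1, ?_⟩
  intro k hk w hw _
  have h1 : ‖(l : ℂ)‖ ≤ ‖(l : ℂ)‖ ^ k := le_self_pow₀ hl.le hk.ne'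
  rw [not_lt, norm_units_smul, Units.val_pow_eq_pow_val, norm_pow]
  calc ‖z‖ * c = (c * c) * (‖z‖ / c) := by field_simp
    _ ≤ ‖(l : ℂ)‖ ^ k * ‖w‖ := by
      rw [hcc]
      exact mul_le_mul h1 hw.le (by positivity) (by positivity)

theorem isWandering_G (hl : 1 < ‖(l : ℂ)‖) : IsWandering (G n l) where
  continuous := by
    refine Continuous.subtype_mk ?_ _
    exact (continuous_subtype_val.const_smul l)
  continuous_symm := by
    refine Continuous.subtype_mk ?_ _
    exact (continuous_subtype_val.const_smul l⁻¹)
  exists_nhds e := by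
    obtain ⟨a, b, ha, hb, h⟩ := exists_annulus_nhds hl e.2
    refine ⟨{w : Htilde n | a < ‖w.1‖ ∧ ‖w.1‖ < b}, ?_, ?_⟩
    · refine IsOpen.mem_nhds ?_ ⟨ha, hb⟩
      exact isOpen_Ioo.preimage continuous_subtype_val.norm
    · rintro k hk x ⟨hx1, hx2⟩ ⟨-, h2⟩
      rw [G_pow_apply] at h2
      exact h k hk x.1 hx1 hx2 h2

theorem lt_pow_half (hφ : ∀ x : ℝ≥0, 0 < x → x < φ.1 x) {k : ℕ} (hk : 0 < k) {x : ℝ≥0}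
    (hx : 0 < x) : φ.1 x ≤ (φ ^ k).1 x := by
  induction k, hk using Nat.le_induction with
  | base => simp
  | succ k hk ih =>
    rw [pow_succ']
    show φ.1 x ≤ φ.1 ((φ ^ k).1 x)
    exact ih.trans (hφ _ (map_pos_half _ hx)).le

theorem inv_lt_half (hφ : ∀ x : ℝ≥0, 0 < x → x < φ.1 x) {x : ℝ≥0} (hx : 0 < x) :
    φ⁻¹.1 x < x := by
  have h := hφ (φ⁻¹.1 x) (map_pos_half φ⁻¹ hx)
  have h2 : φ.1 (φ⁻¹.1 x) = x := φ.1.apply_symm_apply x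
  rwa [h2] at h

theorem continuous_T : Continuous (T n l φ) := by
  refine Continuous.subtype_mk ?_ _
  exact (continuous_subtype_val.fst.const_smul l).prodMk
    (φ.2.1.continuous.comp continuous_subtype_val.snd)

/-- Off the axis $z=0$ a shell in $z$ wanders because $|\lambda|>1$. On the axis $x>0$, and a slab
$a<x<\varphi(a)$ wanders because $\varphi$ moves points upwards. -/
theorem isWandering_T (hl : 1 < ‖(l : ℂ)‖) (hφ : ∀ x : ℝ≥0, 0 < x → x < φ.1 x) :
    IsWandering (T n l φ) where
  continuous := continuous_T
  continuous_symm := continuous_T (l := l⁻¹) (φ := φ⁻¹)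
  exists_nhds e := by
    by_cases hz : e.1.1 = 0
    · have hx : 0 < e.1.2 := by
        rw [pos_iff_ne_zero]
        exact fun h => e.2 (Prod.ext hz h)
      obtain ⟨a, ha1, ha2⟩ := exists_between (inv_lt_half hφ hx)
      have ha : e.1.2 < φ.1 a := by
        have := strictMono_half φ ha1
        have h2 : φ.1 (φ⁻¹.1 e.1.2) = e.1.2 := φ.1.apply_symm_apply _
        rwa [h2] at this
      refine ⟨{w : Rtilde n | a < w.1.2 ∧ w.1.2 < φ.1 a}, ?_, ?_⟩
      · refine IsOpen.mem_nhds ?_ ⟨ha2, ha⟩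
        exact isOpen_Ioo.preimage continuous_subtype_val.snd
      · rintro k hk x ⟨hx1, hx2⟩ ⟨-, h2⟩
        rw [T_pow_apply] at h2
        have h3 := lt_pow_half hφ hk (pos_of_gt hx1)
        exact absurd (h3.trans_lt h2) (strictMono_half φ hx1).le.not_gt
    · obtain ⟨a, b, ha, hb, h⟩ := exists_annulus_nhds hl hz
      refine ⟨{w : Rtilde n | a < ‖w.1.1‖ ∧ ‖w.1.1‖ < b}, ?_, ?_⟩
      · refine IsOpen.mem_nhds ?_ ⟨ha, hb⟩
        exact isOpen_Ioo.preimage continuous_subtype_val.fst.norm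
      · rintro k hk x ⟨hx1, hx2⟩ ⟨-, h2⟩
        rw [T_pow_apply] at h2
        exact h k hk x.1.1 hx1 hx2 h2

/-! ### Lifts of leafwise holomorphic maps -/

theorem isEmbedding_incl : Topology.IsEmbedding (incl (n := n)) :=
  (Topology.IsEmbedding.id.prodMap NNReal.isEmbedding_coe).comp Topology.IsEmbedding.subtypeVal

theorem G_zpow_apply (k : ℤ) (z : Htilde n) : ((G n l ^ k) z).1 = l ^ k • z.1 := by
  induction k using Int.induction_on generalizing z with
  | zero => simp
  | succ k ih =>
    rw [zpow_add_one, Equiv.Perm.mul_apply, ih, zpow_add_one, mul_smul]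
    rfl
  | pred k ih =>
    rw [zpow_sub_one, Equiv.Perm.mul_apply, ih, zpow_sub_one, mul_smul]
    rfl

theorem T_zpow_apply (k : ℤ) (p : Rtilde n) :
    ((T n l φ ^ k) p).1 = (l ^ k • p.1.1, (φ ^ k).1 p.1.2) := by
  induction k using Int.induction_on generalizing p with
  | zero => simp
  | succ k ih =>
    rw [zpow_add_one, Equiv.Perm.mul_apply, ih, zpow_add_one, mul_smul, zpow_add_one]
    rfl
  | pred k ih =>
    rw [zpow_sub_one, Equiv.Perm.mul_apply, ih, zpow_sub_one, mul_smul, zpow_sub_one]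
    rfl

theorem projR_eq_iff {p q : Rtilde n} :
    (projR p : R n l φ) = projR q ↔ ∃ k : ℤ, (T n l φ ^ k) p = q :=
  mk_eq_mk_iff_zpow

theorem projH_eq_iff {p q : Htilde n} :
    (projH p : H n l) = projH q ↔ ∃ k : ℤ, (G n l ^ k) p = q :=
  mk_eq_mk_iff_zpow

/-- Near `p`, the self-map `F` of `ℂⁿ × [0,∞) \ {(O,0)}` is smooth, maps leaves into leaves and is
holomorphic along the leaves. -/
def IsLeafHoloAt (F : Rtilde n → Rtilde n) (p : Rtilde n) : Prop :=
  ∃ (U : Set ((Fin n → ℂ) × ℝ)) (Φ : (Fin n → ℂ) × ℝ → (Fin n → ℂ) × ℝ),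
    IsOpen U ∧ incl p ∈ U ∧ ContDiffOn ℝ ∞ Φ (U ∩ Set.range (incl (n := n))) ∧
    ∀ q : Rtilde n, incl q ∈ U →
      incl (F q) = Φ (incl q) ∧
      (∀ᶠ w in 𝓝 q.1.1, (Φ (w, (q.1.2 : ℝ))).2 = (Φ (incl q)).2) ∧
      DifferentiableAt ℂ (fun w => (Φ (w, (q.1.2 : ℝ))).1) q.1.1

/-- Self-maps of `ℂⁿ × [0,∞) \ {(O,0)}` that are smooth, preserve the leaves and are holomorphic
along the leaves. -/
def IsLeafHoloLift (F : Rtilde n → Rtilde n) : Prop := ∀ p : Rtilde n, IsLeafHoloAt F p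

theorem IsLeafHoloAt.congr {F F' : Rtilde n → Rtilde n} {p : Rtilde n} (hF : IsLeafHoloAt F p)
    (h : ∀ᶠ q in 𝓝 p, F q = F' q) : IsLeafHoloAt F' p := by
  obtain ⟨U, Φ, hU, hp, hΦ, hq⟩ := hF
  rw [isEmbedding_incl.nhds_eq_comap, Filter.eventually_comap] at h
  obtain ⟨W, hW, hWo, hpW⟩ := eventually_nhds_iff.mp h
  refine ⟨U ∩ W, Φ, hU.inter hWo, ⟨hp, hpW⟩,
    hΦ.mono (Set.inter_subset_inter_left _ Set.inter_subset_left), fun q hqq => ?_⟩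
  rw [← hW _ hqq.2 q rfl]
  exact hq q hqq.1

theorem IsLeafHoloAt.zpow {F : Rtilde n → Rtilde n} {p : Rtilde n} (hF : IsLeafHoloAt F p)
    (l : ℂˣ) (φ : DiffHalf) (k : ℤ) : IsLeafHoloAt (fun q => (T n l φ ^ k) (F q)) p := by
  obtain ⟨U, Φ, hU, hp, hΦ, h⟩ := hF
  refine ⟨U, fun y => (l ^ k • (Φ y).1, onReal (φ ^ k).1 (Φ y).2), hU, hp, ?_, ?_⟩
  · refine ContDiffOn.prodMk ?_ ?_
    · exact hΦ.fst.const_smul (l ^ k)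
    · have hφk : ContDiffOn ℝ ∞ (onReal (φ ^ k).1) (Set.Ici 0) := (φ ^ k).2.1
      refine hφk.comp hΦ.snd ?_
      rintro _ ⟨hx, q, rfl⟩
      show (Φ (incl q)).2 ∈ Set.Ici 0
      rw [← (h q hx).1]
      exact (F q).1.2.2
  · intro q hqU
    obtain ⟨h1, h2, h3⟩ := h q hqU
    refine ⟨?_, ?_, ?_⟩
    · show _ = (l ^ k • (Φ (incl q)).1, onReal (φ ^ k).1 (Φ (incl q)).2)
      rw [← h1]
      simp only [incl, T_zpow_apply, onReal, Real.toNNReal_coe]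
    · filter_upwards [h2] with w hw
      simp only [hw]
    · exact h3.const_smul (l ^ k)

theorem continuousAt_of_incl_eq {F : Rtilde n → Rtilde n}
    {U : Set ((Fin n → ℂ) × ℝ)} {Φ : (Fin n → ℂ) × ℝ → (Fin n → ℂ) × ℝ} (hU : IsOpen U)
    (hΦ : ContDiffOn ℝ ∞ Φ (U ∩ Set.range (incl (n := n))))
    (h : ∀ q : Rtilde n, incl q ∈ U → incl (F q) = Φ (incl q)) {q : Rtilde n} (hq : incl q ∈ U) :
    ContinuousAt F q := by
  rw [isEmbedding_incl.continuousAt_iff]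
  have hO : IsOpen (incl (n := n) ⁻¹' U) := hU.preimage isEmbedding_incl.continuous
  have h1 : ContinuousOn (fun q => Φ (incl q)) (incl (n := n) ⁻¹' U) :=
    hΦ.continuousOn.comp isEmbedding_incl.continuous.continuousOn (fun x hx => ⟨hx, x, rfl⟩)
  refine (h1.continuousAt (hO.mem_nhds hq)).congr ?_
  filter_upwards [hO.mem_nhds hq] with x hx
  exact (h x hx).symm

theorem IsLeafHolo.exists_section {f : R n l φ → R n l φ} (hf : IsLeafHolo f) (p : Rtilde n) :
    ∃ (U : Set ((Fin n → ℂ) × ℝ)) (Φ : (Fin n → ℂ) × ℝ → (Fin n → ℂ) × ℝ)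
      (s : Rtilde n → Rtilde n),
    IsOpen U ∧ incl p ∈ U ∧ ContDiffOn ℝ ∞ Φ (U ∩ Set.range (incl (n := n))) ∧
    ∀ q : Rtilde n, incl q ∈ U →
      incl (s q) = Φ (incl q) ∧ f (projR q) = projR (s q) ∧
      (∀ᶠ w in 𝓝 q.1.1, (Φ (w, (q.1.2 : ℝ))).2 = (Φ (incl q)).2) ∧
      DifferentiableAt ℂ (fun w => (Φ (w, (q.1.2 : ℝ))).1) q.1.1 := by
  obtain ⟨U, Φ, hU, hp, hΦ, h⟩ := hf.exists_local p
  have h1 : ∀ q : Rtilde n, ∃ q' : Rtilde n, incl q ∈ U →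
      incl q' = Φ (incl q) ∧ f (projR q) = projR q' := fun q => by
    by_cases hq : incl q ∈ U
    · obtain ⟨⟨q', hq'⟩, -⟩ := h q hq
      exact ⟨q', fun _ => hq'⟩
    · exact ⟨q, fun h => absurd h hq⟩
  choose s hs using h1
  exact ⟨U, Φ, s, hU, hp, hΦ, fun q hq => ⟨(hs q hq).1, (hs q hq).2, (h q hq).2⟩⟩

theorem continuous_projR : Continuous (Quotient.mk (MulAction.orbitRel
    (Subgroup.zpowers (T n l φ)) (Rtilde n))) := continuous_quot_mk

theorem IsLeafHolo.continuous_comp_projR {f : R n l φ → R n l φ} (hf : IsLeafHolo f) :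
    Continuous (Y := Quotient (MulAction.orbitRel (Subgroup.zpowers (T n l φ)) (Rtilde n)))
      (fun p : Rtilde n => f (projR p)) := by
  refine continuous_iff_continuousAt.mpr fun p => ?_
  obtain ⟨U, Φ, s, hU, hp, hΦ, h⟩ := hf.exists_section p
  have hs := continuousAt_of_incl_eq hU hΦ (fun q hq => (h q hq).1) hp
  refine (continuous_projR.continuousAt.comp hs).congr ?_
  filter_upwards [(hU.preimage isEmbedding_incl.continuous).mem_nhds hp] with q hq
  exact (h q hq).2.1.symm

/-- A continuous lift exists by contractibility. Near each point it agrees with a local coordinate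
expression up to a power of $T$, which is itself smooth and leafwise holomorphic. -/
theorem IsLeafHolo.exists_lift (hl : 1 < ‖(l : ℂ)‖) (hφ : ∀ x : ℝ≥0, 0 < x → x < φ.1 x)
    {f : R n l φ → R n l φ} (hf : IsLeafHolo f) :
    ∃ F : Rtilde n → Rtilde n, IsLeafHoloLift F ∧ ∀ p, projR (F p) = f (projR p) := by
  obtain ⟨F, hF, hFf⟩ := (isWandering_T (n := n) hl hφ).exists_lift hf.continuous_comp_projR
  refine ⟨F, fun p => ?_, hFf⟩
  obtain ⟨U, Φ, s, hU, hp, hΦ, h⟩ := hf.exists_section p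
  obtain ⟨k, hk⟩ := (isWandering_T (n := n) hl hφ).eventually_eq_zpow
    (continuousAt_of_incl_eq hU hΦ (fun q hq => (h q hq).1) hp) hF.continuousAt (by
      filter_upwards [(hU.preimage (isEmbedding_incl (n := n)).continuous).mem_nhds hp] with q hq
      exact (h q hq).2.1.symm.trans (hFf q).symm)
  have hs : IsLeafHoloAt s p := ⟨U, Φ, hU, hp, hΦ, fun q hq => ⟨(h q hq).1, (h q hq).2.2⟩⟩
  exact (hs.zpow l φ k).congr hk

/-- The point of `ℂⁿ × [0,∞) \ {(O,0)}` with given coordinates (a default point for `(O,0)`). -/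
def toR (p : (Fin n → ℂ) × ℝ≥0) : Rtilde n := by
  classical exact if h : p ≠ 0 then ⟨p, h⟩ else basePoint n

theorem toR_val {p : (Fin n → ℂ) × ℝ≥0} (hp : p ≠ 0) : (toR p).1 = p := by
  simp [toR, hp]

theorem toR_coe (q : Rtilde n) : toR q.1 = q := Subtype.ext (toR_val q.2)

theorem ne_zero_left {z : Fin n → ℂ} (hz : z ≠ 0) (x : ℝ≥0) : (z, x) ≠ 0 :=
  fun h => hz (congrArg Prod.fst h)

theorem ne_zero_right (z : Fin n → ℂ) {x : ℝ≥0} (hx : 0 < x) : (z, x) ≠ 0 :=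
  fun h => hx.ne' (congrArg Prod.snd h)

theorem continuousAt_toR {p : (Fin n → ℂ) × ℝ≥0} (hp : p ≠ 0) : ContinuousAt toR p := by
  rw [Topology.IsEmbedding.subtypeVal.continuousAt_iff]
  refine continuousAt_id.congr ?_
  filter_upwards [isOpen_compl_singleton.mem_nhds hp] with q hq
  exact (toR_val hq).symm

theorem incl_toR {p : (Fin n → ℂ) × ℝ≥0} (hp : p ≠ 0) : incl (toR p) = (p.1, (p.2 : ℝ)) := by
  rw [incl, toR_val hp]

theorem eventually_incl (q : Rtilde n) {U : Set ((Fin n → ℂ) × ℝ)} (hU : IsOpen U)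
    (hq : incl q ∈ U) :
    ∀ᶠ w in 𝓝 q.1.1, ((w, q.1.2) : (Fin n → ℂ) × ℝ≥0) ≠ 0 ∧ (w, (q.1.2 : ℝ)) ∈ U := by
  have h1 : Continuous fun w : Fin n → ℂ => ((w, q.1.2) : (Fin n → ℂ) × ℝ≥0) := by fun_prop
  have h2 : Continuous fun w : Fin n → ℂ => ((w, (q.1.2 : ℝ)) : (Fin n → ℂ) × ℝ) := by fun_prop
  exact (h1.continuousAt.eventually (isOpen_compl_singleton.mem_nhds q.2)).and
    (h2.continuousAt.eventually (hU.mem_nhds hq))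

namespace IsLeafHoloLift

variable {F : Rtilde n → Rtilde n} (hF : IsLeafHoloLift F)
include hF

theorem continuous : Continuous F := by
  rw [continuous_iff_continuousAt]
  intro p
  obtain ⟨U, Φ, hU, hp, hΦ, h⟩ := hF p
  exact continuousAt_of_incl_eq hU hΦ (fun q hq => (h q hq).1) hp

theorem eventually_snd_eq (q : Rtilde n) :
    ∀ᶠ w in 𝓝 q.1.1, (F (toR (w, q.1.2))).1.2 = (F q).1.2 := by
  obtain ⟨U, Φ, hU, hp, hΦ, h⟩ := hF q
  filter_upwards [eventually_incl q hU hp, (h q hp).2.1] with w hw hw2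
  have h1 := (h (toR (w, q.1.2)) (by rw [incl_toR hw.1]; exact hw.2)).1
  rw [incl_toR hw.1] at h1
  have h2 := (h q hp).1
  exact NNReal.coe_injective ((congrArg Prod.snd h1).trans
    (hw2.trans (congrArg Prod.snd h2).symm))

theorem differentiableAt (q : Rtilde n) :
    DifferentiableAt ℂ (fun w => (F (toR (w, q.1.2))).1.1) q.1.1 := by
  obtain ⟨U, Φ, hU, hp, hΦ, h⟩ := hF q
  refine (h q hp).2.2.congr_of_eventuallyEq ?_
  filter_upwards [eventually_incl q hU hp] with w hw
  have h1 := (h (toR (w, q.1.2)) (by rw [incl_toR hw.1]; exact hw.2)).1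
  rw [incl_toR hw.1] at h1
  exact congrArg Prod.fst h1

theorem differentiable {x : ℝ≥0} (hx : 0 < x) :
    Differentiable ℂ (fun w => (F (toR (w, x))).1.1) := by
  intro w
  have := hF.differentiableAt (toR (w, x))
  rwa [toR_val (ne_zero_right w hx)] at this

/-- The ray $\{z\}\times[0,\infty)$ with $z\ne0$ misses the deleted point, so smoothness in $x$ up
to the boundary can be read along it. It yields the smoothness of both $\eta$ and $\beta$. -/
theorem contDiffOn_slice {z : Fin n → ℂ} (hz : z ≠ 0) :
    ContDiffOn ℝ ∞ (fun x : ℝ => incl (F (toR (z, x.toNNReal)))) (Set.Ici 0) := by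
  intro x hx
  have hx' : (x.toNNReal : ℝ) = x := Real.coe_toNNReal x hx
  obtain ⟨U, Φ, hU, hp, hΦ, h⟩ := hF (toR (z, x.toNNReal))
  rw [incl_toR (ne_zero_left hz _)] at hp
  simp only [hx'] at hp
  have hc : ContDiff ℝ ∞ fun y : ℝ => ((z, y) : (Fin n → ℂ) × ℝ) := by fun_prop
  have hin : ∀ y : ℝ, 0 ≤ y → incl (toR (z, y.toNNReal)) = (z, y) := fun y hy => by
    rw [incl_toR (ne_zero_left hz _)]
    simp [hy]
  have hV : (fun y : ℝ => ((z, y) : (Fin n → ℂ) × ℝ)) ⁻¹' U ∈ 𝓝 x :=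
    (hU.preimage hc.continuous).mem_nhds hp
  have h1 : ContDiffWithinAt ℝ ∞ (fun y : ℝ => Φ (z, y))
      (Set.Ici 0 ∩ (fun y : ℝ => ((z, y) : (Fin n → ℂ) × ℝ)) ⁻¹' U) x := by
    refine ContDiffWithinAt.comp x (hΦ (z, x) ⟨hp, _, hin x hx⟩) hc.contDiffWithinAt ?_
    exact fun y hy => ⟨hy.2, _, hin y hy.1⟩
  rw [contDiffWithinAt_inter hV] at h1
  refine h1.congr_of_eventuallyEq ?_ ?_
  · filter_upwards [self_mem_nhdsWithin, mem_nhdsWithin_of_mem_nhds hV] with y hy hy2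
    rw [(h (toR (z, y.toNNReal)) (by rw [hin y hy]; exact hy2)).1, hin y hy]
  · rw [(h (toR (z, x.toNNReal)) (by rw [hin x hx]; exact hp)).1, hin x hx]

/-- The transverse coordinate of $F$ is locally constant along leaves, and each leaf is connected:
it is $\mathbb{C}^n$, or $\mathbb{C}^n\setminus\{O\}$ at $x=0$. -/
theorem snd_eq_of_snd_eq (hn : 1 ≤ n) {p q : Rtilde n} (hpq : p.1.2 = q.1.2) :
    (F p).1.2 = (F q).1.2 := by
  set S : Set (Fin n → ℂ) := {w | ((w, q.1.2) : (Fin n → ℂ) × ℝ≥0) ≠ 0} with hS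
  have hSc : IsPreconnected S := by
    by_cases hq : q.1.2 = 0
    · have : S = {0}ᶜ := by
        ext w
        simp [hS, hq]
      rw [this]
      exact (isConnected_compl_zero hn 0).isPreconnected
    · have : S = Set.univ := by
        ext w
        simp [hS, hq]
      rw [this]
      exact isPreconnected_univ
  have := isPreconnected_iff_preconnectedSpace.mp hSc
  have hlc : IsLocallyConstant fun w : S => (F (toR (w.1, q.1.2))).1.2 := by
    rw [IsLocallyConstant.iff_eventually_eq]
    intro w
    have h1 := hF.eventually_snd_eq (toR (w.1, q.1.2))
    rw [toR_val w.2] at h1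
    exact continuousAt_subtype_val.eventually h1
  have h2 := hlc.apply_eq_of_preconnectedSpace ⟨p.1.1, by rw [hS, Set.mem_ofPred, ← hpq]; exact p.2⟩
    ⟨q.1.1, q.2⟩
  simp only at h2
  rwa [← hpq, toR_coe, hpq, toR_coe] at h2

end IsLeafHoloLift

/-! ### Lifts of automorphisms and restriction to the boundary -/

theorem exists_perm_lift (hl : 1 < ‖(l : ℂ)‖) (hφ : ∀ x : ℝ≥0, 0 < x → x < φ.1 x)
    (f : AutR n l φ) :
    ∃ F : Equiv.Perm (Rtilde n), IsLeafHoloLift F ∧ IsLeafHoloLift F.symm ∧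
      ∀ p, (projR (F p) : R n l φ) = f.1 (projR p) := by
  have hT := isWandering_T (n := n) hl hφ
  obtain ⟨F, hF, hFf⟩ := f.2.1.exists_lift hl hφ
  obtain ⟨E, hE, hEf⟩ := f.2.2.exists_lift hl hφ
  obtain ⟨k, h1, h2⟩ := hT.exists_inverse_lift hF.continuous hE.continuous hFf hEf
  exact ⟨⟨F, _, h1, h2⟩, hF, fun p => (hE p).zpow l φ k, hFf⟩

/-- The map $T$ preserves the leaf $x=0$, so $T^m$ preserves its image leaf $x=c$. For $c>0$ this
gives $m=0$, hence $F\circ T=F$, contradicting injectivity. -/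
theorem snd_lift_eq_zero (hn : 1 ≤ n) (hl : 1 < ‖(l : ℂ)‖) (hφ : ∀ x : ℝ≥0, 0 < x → x < φ.1 x)
    {f : R n l φ → R n l φ} {F : Equiv.Perm (Rtilde n)} (hF : IsLeafHoloLift F)
    (hFf : ∀ p, projR (F p) = f (projR p)) {p : Rtilde n} (hp : p.1.2 = 0) :
    (F p).1.2 = 0 := by
  have hT := isWandering_T (n := n) hl hφ
  obtain ⟨m, hm⟩ := hT.exists_zpow_comp hF.continuous hFf
  by_contra h0
  have h1 : (F (T n l φ p)).1.2 = (F p).1.2 := hF.snd_eq_of_snd_eq hn (by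
    show φ.1 p.1.2 = p.1.2
    rw [hp, map_zero_half])
  rw [hm, T_zpow_apply] at h1
  have hm0 : m = 0 := by
    -- The point $(O,c)$ of the image leaf turns $\varphi^m(c)=c$ into a fixed point of $T^m$, since
    -- scaling does not move $O$.
    refine hT.zpow_eq_zero (x := toR (0, (F p).1.2)) (Subtype.ext ?_)
    rw [T_zpow_apply, toR_val (ne_zero_right _ (pos_iff_ne_zero.mpr h0)), smul_zero]
    exact Prod.ext rfl h1
  have h2 := hm p
  rw [hm0, zpow_zero, Equiv.Perm.one_apply] at h2
  have h3 : (T n l φ ^ (1 : ℤ)) p = p := by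
    rw [zpow_one]
    exact F.injective h2
  exact one_ne_zero (hT.zpow_eq_zero h3)

theorem bdry_injective : Function.Injective (bdry : H n l → R n l φ) := by
  intro a b hab
  obtain ⟨a, rfl⟩ := Quotient.exists_rep a
  obtain ⟨b, rfl⟩ := Quotient.exists_rep b
  obtain ⟨k, hk⟩ := projR_eq_iff.mp (show (projR (bdryTilde a) : R n l φ) = projR (bdryTilde b)
    from hab)
  refine projH_eq_iff.mpr ⟨k, Subtype.ext ?_⟩
  have h1 := congrArg (fun p => p.1.1) hk
  simp only [T_zpow_apply] at h1
  rw [G_zpow_apply]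
  exact h1

theorem exists_eq_bdryTilde {p : Rtilde n} (hp : p.1.2 = 0) : ∃ z : Htilde n, bdryTilde z = p :=
  ⟨⟨p.1.1, fun h => p.2 (Prod.ext h hp)⟩, Subtype.ext (Prod.ext rfl hp.symm)⟩

theorem exists_bdry_eq (hn : 1 ≤ n) (hl : 1 < ‖(l : ℂ)‖) (hφ : ∀ x : ℝ≥0, 0 < x → x < φ.1 x)
    (f : AutR n l φ) (h : H n l) : ∃ h' : H n l, bdry h' = f.1 (bdry h) := by
  obtain ⟨z, rfl⟩ := Quotient.exists_rep h
  obtain ⟨F, hF, -, hFf⟩ := exists_perm_lift hl hφ f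
  obtain ⟨w, hw⟩ := exists_eq_bdryTilde
    (snd_lift_eq_zero hn hl hφ hF hFf (p := bdryTilde z) rfl)
  refine ⟨projH w, ?_⟩
  show (projR (bdryTilde w) : R n l φ) = f.1 (projR (bdryTilde z))
  rw [hw, hFf]

/-- The permutation of `H` induced by an automorphism of `R`. -/
def restrictPerm (hn : 1 ≤ n) (hl : 1 < ‖(l : ℂ)‖) (hφ : ∀ x : ℝ≥0, 0 < x → x < φ.1 x) :
    AutR n l φ →* Equiv.Perm (H n l) :=
  MonoidHom.toHomPerm
    { toFun := fun f h => (exists_bdry_eq hn hl hφ f h).choose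
      map_one' := by
        funext h
        exact bdry_injective (exists_bdry_eq hn hl hφ 1 h).choose_spec
      map_mul' := fun f g => by
        funext h
        apply bdry_injective (φ := φ)
        rw [(exists_bdry_eq hn hl hφ (f * g) h).choose_spec]
        show f.1 (g.1 (bdry h)) = bdry (exists_bdry_eq hn hl hφ f _).choose
        rw [(exists_bdry_eq hn hl hφ f _).choose_spec, (exists_bdry_eq hn hl hφ g h).choose_spec] }

theorem bdry_restrictPerm (hn : 1 ≤ n) (hl : 1 < ‖(l : ℂ)‖)
    (hφ : ∀ x : ℝ≥0, 0 < x → x < φ.1 x) (f : AutR n l φ) (h : H n l) :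
    bdry (restrictPerm hn hl hφ f h) = f.1 (bdry h) :=
  (exists_bdry_eq hn hl hφ f h).choose_spec

/-- A local expression of `f`, restricted to $x=0$, is a local expression of `g`. A chosen
representative of `g` may differ from it by a power of $T$, which on the boundary is a power of $G$.
-/
theorem isHolo_of_bdry_eq {f : R n l φ → R n l φ} (hf : IsLeafHolo f) {g : H n l → H n l}
    (h : ∀ x, bdry (g x) = f (bdry x)) : IsHolo g := by
  intro p
  obtain ⟨U, Φ, s, hU, hp, hΦ, hq⟩ := hf.exists_section (bdryTilde p)
  have hc : Continuous fun w : Fin n → ℂ => ((w, 0) : (Fin n → ℂ) × ℝ) := by fun_prop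
  refine ⟨(fun w => ((w, 0) : (Fin n → ℂ) × ℝ)) ⁻¹' U ∩ {0}ᶜ, fun w => (Φ (w, 0)).1,
    (hU.preimage hc).inter isOpen_compl_singleton, ⟨hp, p.2⟩, ?_, ?_⟩
  · rintro w ⟨hw, hw0⟩
    exact (hq (bdryTilde ⟨w, hw0⟩) hw).2.2.2.differentiableWithinAt
  · rintro q ⟨hqU, -⟩
    obtain ⟨h1, h2, -⟩ := hq (bdryTilde q) hqU
    obtain ⟨y, hy⟩ := Quotient.exists_rep (g (projH q))
    have h3 : (projR (bdryTilde y) : R n l φ) = projR (s (bdryTilde q)) := by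
      rw [← h2]
      refine Eq.trans ?_ (h (projH q))
      rw [← hy]
      rfl
    obtain ⟨k, hk⟩ := projR_eq_iff.mp h3
    rw [← bdryTilde_zpow] at hk
    refine ⟨(G n l ^ k) y, ?_, ?_⟩
    · rw [← hk] at h1
      exact congrArg Prod.fst h1
    · rw [← hy]
      exact projH_eq_iff.mpr ⟨k, rfl⟩

/-- The restriction homomorphism `Aut R → Aut H`. -/
def restrictHom (hn : 1 ≤ n) (hl : 1 < ‖(l : ℂ)‖) (hφ : ∀ x : ℝ≥0, 0 < x → x < φ.1 x) :
    AutR n l φ →* AutH n l :=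
  (restrictPerm hn hl hφ).codRestrict (AutH n l) fun f =>
    ⟨isHolo_of_bdry_eq f.2.1 (bdry_restrictPerm hn hl hφ f), by
      have : (restrictPerm hn hl hφ f).symm = restrictPerm hn hl hφ f⁻¹ :=
        (map_inv (restrictPerm hn hl hφ) f).symm
      rw [this]
      exact isHolo_of_bdry_eq f.2.2 (bdry_restrictPerm hn hl hφ f⁻¹)⟩

theorem ker_restrictHom (hn : 1 ≤ n) (hl : 1 < ‖(l : ℂ)‖) (hφ : ∀ x : ℝ≥0, 0 < x → x < φ.1 x) :
    (restrictHom (n := n) hn hl hφ).ker = AutRH n l φ := by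
  ext f
  rw [MonoidHom.mem_ker]
  constructor
  · intro hf h
    rw [← bdry_restrictPerm hn hl hφ f h]
    have : restrictPerm hn hl hφ f = 1 := congrArg Subtype.val hf
    rw [this]
    rfl
  · intro hf
    apply Subtype.ext
    refine Equiv.ext fun h => ?_
    apply bdry_injective (φ := φ)
    exact (bdry_restrictPerm hn hl hφ f h).trans (hf h)

/-! ### Automorphisms of `R` given by global formulas -/

theorem isLeafHolo_quotientPerm (u : Subgroup.centralizer {T n l φ})
    {M : (Fin n → ℂ) × ℝ → (Fin n → ℂ)} {η : ℝ≥0 → ℝ≥0} (hη : SmoothHalf η)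
    (hM : ContDiffOn ℝ ∞ M (Set.range (incl (n := n))))
    (hMd : ∀ x : ℝ, Differentiable ℂ fun w => M (w, x))
    (hu : ∀ p, (u.1 p).1 = (M (incl p), η p.1.2)) :
    IsLeafHolo (n := n) (l := l) (φ := φ) (quotientPerm (T n l φ) u) where
  map_leaf c := by
    refine ⟨η c, ?_⟩
    rintro _ ⟨_, ⟨p, rfl, rfl⟩, rfl⟩
    exact ⟨u.1 p, congrArg Prod.snd (hu p), rfl⟩
  exists_local p := by
    refine ⟨Set.univ, fun y => (M y, onReal η y.2), isOpen_univ, trivial, ?_, ?_⟩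
    · rw [Set.univ_inter]
      refine hM.prodMk ?_
      refine ContDiffOn.comp (t := Set.Ici (0 : ℝ)) hη contDiff_snd.contDiffOn ?_
      rintro _ ⟨q, rfl⟩
      exact q.1.2.2
    · intro q _
      refine ⟨⟨u.1 q, ?_, rfl⟩, Filter.Eventually.of_forall fun w => rfl, (hMd _).differentiableAt⟩
      rw [incl, hu]
      simp [onReal, incl]

/-! ### Entire functions of linear growth -/

/-- Cauchy's estimate on the disc of radius $1+|t|$ about $t$ bounds the derivative uniformly, and
Liouville's theorem makes it constant. -/
theorem exists_affine_of_norm_le {V : Type*} [NormedAddCommGroup V] [NormedSpace ℂ V]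
    [CompleteSpace V] {f : ℂ → V} (hf : Differentiable ℂ f) {C : ℝ}
    (hC : ∀ t, ‖f t‖ ≤ C * (1 + ‖t‖)) : ∃ c, ∀ t, f t = f 0 + t • c := by
  have hC0 : 0 ≤ C := by simpa using (norm_nonneg _).trans (hC 0)
  have hd : Differentiable ℂ (deriv f) := fun t =>
    (hf.differentiableOn.deriv isOpen_univ).differentiableAt Filter.univ_mem
  have hb : ∀ t, ‖deriv f t‖ ≤ 2 * C := by
    intro t
    have hR : 0 < 1 + ‖t‖ := by positivity
    -- On this circle $1+|z|\le2(1+|t|)$, so the estimate is $2C$ independently of $t$.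
    have h := Complex.norm_deriv_le_of_forall_mem_sphere_norm_le (c := t) (f := f)
      (C := C * (2 * (1 + ‖t‖))) hR hf.diffContOnCl (fun z hz => by
        refine (hC z).trans (mul_le_mul_of_nonneg_left ?_ hC0)
        have h1 : ‖z‖ ≤ ‖t‖ + ‖z - t‖ := by simpa using norm_add_le t (z - t)
        rw [mem_sphere_iff_norm] at hz
        linarith)
    refine h.trans_eq ?_
    field_simp
  obtain ⟨c, hc⟩ := hd.exists_const_forall_eq_of_bounded
    (isBounded_iff_forall_norm_le.mpr ⟨2 * C, by rintro _ ⟨t, rfl⟩; exact hb t⟩)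
  refine ⟨c, fun t => ?_⟩
  have h1 : Differentiable ℂ fun t : ℂ => f t - t • c := hf.sub (differentiable_id.smul_const c)
  have h2 := is_const_of_deriv_eq_zero h1 (fun s => by
    have h3 : HasDerivAt (fun t : ℂ => f t - t • c) (deriv f s - (1 : ℂ) • c) s :=
      (hf s).hasDerivAt.sub ((hasDerivAt_id s).smul_const c)
    rw [h3.deriv, hc, one_smul, sub_self]) t 0
  simp only [zero_smul, sub_zero] at h2
  rw [← h2]
  abel

/-! ### Automorphisms of `H` -/

/-- The coordinates of a self-map of `ℂⁿ \ {O}`, extended by `O` at the origin. -/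
def extH (F : Htilde n → Htilde n) (z : Fin n → ℂ) : Fin n → ℂ := by
  classical exact if h : z ≠ 0 then (F ⟨z, h⟩).1 else 0

theorem extH_coe (F : Htilde n → Htilde n) (z : Htilde n) : extH F z.1 = (F z).1 := by
  simp [extH, z.2]

theorem extH_zero (F : Htilde n → Htilde n) : extH F 0 = 0 := by
  simp [extH]

theorem extH_of_ne (F : Htilde n → Htilde n) {z : Fin n → ℂ} (hz : z ≠ 0) :
    extH F z = (F ⟨z, hz⟩).1 := extH_coe F ⟨z, hz⟩

theorem continuousAt_of_coe_eq {s : Htilde n → Htilde n} {U : Set (Fin n → ℂ)}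
    {Φ : (Fin n → ℂ) → (Fin n → ℂ)} (hU : IsOpen U) (hΦ : DifferentiableOn ℂ Φ U)
    (h : ∀ q : Htilde n, q.1 ∈ U → (s q).1 = Φ q.1) {p : Htilde n} (hp : p.1 ∈ U) :
    ContinuousAt s p := by
  rw [Topology.IsEmbedding.subtypeVal.continuousAt_iff]
  have h1 : ContinuousAt (fun q : Htilde n => Φ q.1) p :=
    ContinuousAt.comp (g := Φ) (hΦ.continuousOn.continuousAt (hU.mem_nhds hp))
      continuousAt_subtype_val
  refine h1.congr ?_
  filter_upwards [(hU.preimage continuous_subtype_val).mem_nhds hp] with q hq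
  exact (h q hq).symm

theorem IsHolo.exists_section {f : H n l → H n l} (hf : IsHolo f) (p : Htilde n) :
    ∃ (U : Set (Fin n → ℂ)) (Φ : (Fin n → ℂ) → (Fin n → ℂ)) (s : Htilde n → Htilde n),
      IsOpen U ∧ p.1 ∈ U ∧ DifferentiableOn ℂ Φ U ∧
      ∀ q : Htilde n, q.1 ∈ U → (s q).1 = Φ q.1 ∧ f (projH q) = projH (s q) := by
  obtain ⟨U, Φ, hU, hp, hΦ, h⟩ := hf p
  have h1 : ∀ q : Htilde n, ∃ q' : Htilde n, q.1 ∈ U →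
      q'.1 = Φ q.1 ∧ f (projH q) = projH q' := fun q => by
    by_cases hq : q.1 ∈ U
    · obtain ⟨q', hq'⟩ := h q hq
      exact ⟨q', fun _ => hq'⟩
    · exact ⟨q, fun h => absurd h hq⟩
  choose s hs using h1
  exact ⟨U, Φ, s, hU, hp, hΦ, hs⟩

theorem IsHolo.continuous_comp_projH {f : H n l → H n l} (hf : IsHolo f) :
    Continuous (Y := Quotient (MulAction.orbitRel (Subgroup.zpowers (G n l)) (Htilde n)))
      (fun p : Htilde n => f (projH p)) := by
  refine continuous_iff_continuousAt.mpr fun p => ?_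
  obtain ⟨U, Φ, s, hU, hp, hΦ, h⟩ := hf.exists_section p
  have hs := continuousAt_of_coe_eq hU hΦ (fun q hq => (h q hq).1) hp
  have hq : Continuous (Quotient.mk (MulAction.orbitRel (Subgroup.zpowers (G n l)) (Htilde n))) :=
    continuous_quot_mk
  refine (hq.continuousAt.comp hs).congr ?_
  filter_upwards [(hU.preimage continuous_subtype_val).mem_nhds hp] with q hq
  exact (h q hq).2.symm

theorem IsHolo.exists_lift (hn : 2 ≤ n) (hl : 1 < ‖(l : ℂ)‖) {f : H n l → H n l}
    (hf : IsHolo f) :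
    ∃ F : Htilde n → Htilde n, Continuous F ∧ (∀ z ≠ 0, DifferentiableAt ℂ (extH F) z) ∧
      ∀ p, projH (F p) = f (projH p) := by
  obtain ⟨F, hF, hFf⟩ := (isWandering_G (n := n) hl).exists_lift_Htilde hn hf.continuous_comp_projH
  refine ⟨F, hF, fun z hz => ?_, hFf⟩
  obtain ⟨U, Φ, s, hU, hp, hΦ, h⟩ := hf.exists_section ⟨z, hz⟩
  obtain ⟨k, hk⟩ := (isWandering_G (n := n) hl).eventually_eq_zpow
    (continuousAt_of_coe_eq hU hΦ (fun q hq => (h q hq).1) hp) hF.continuousAt (by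
      filter_upwards [(hU.preimage continuous_subtype_val).mem_nhds hp] with q hq
      exact (h q hq).2.symm.trans (hFf q).symm)
  rw [nhds_subtype_eq_comap, Filter.eventually_comap] at hk
  refine ((hΦ.differentiableAt (hU.mem_nhds hp)).const_smul (l ^ k)).congr_of_eventuallyEq ?_
  filter_upwards [hk, hU.mem_nhds hp, isOpen_compl_singleton.mem_nhds hz] with w hw hwU hw0
  rw [extH_of_ne F hw0, ← hw ⟨w, hw0⟩ rfl, G_zpow_apply, (h ⟨w, hw0⟩ hwU).1]
  rfl

theorem exists_perm_lift_H (hn : 2 ≤ n) (hl : 1 < ‖(l : ℂ)‖) (f : AutH n l) :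
    ∃ F : Equiv.Perm (Htilde n), Continuous F ∧ Continuous F.symm ∧
      (∀ z ≠ 0, DifferentiableAt ℂ (extH F) z) ∧
      (∀ p, (projH (F p) : H n l) = f.1 (projH p)) ∧
      ∀ p, (projH (F.symm p) : H n l) = f.1.symm (projH p) := by
  have := connectedSpace_Htilde (n := n) (by omega)
  have hG := isWandering_G (n := n) hl
  obtain ⟨F, hF, hFd, hFf⟩ := f.2.1.exists_lift hn hl
  obtain ⟨E, hE, -, hEf⟩ := f.2.2.exists_lift hn hl
  obtain ⟨k, h1, h2⟩ := hG.exists_inverse_lift hF hE hFf hEf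
  refine ⟨⟨F, _, h1, h2⟩, hF,
    (continuous_perm_zpow hG.continuous hG.continuous_symm k).comp hE, hFd, hFf, fun p => ?_⟩
  rw [← hEf]
  exact (projH_eq_iff.mpr ⟨k, rfl⟩).symm

/-! ### Lifts of automorphisms of $H$ are linear -/

theorem IsWandering.apply_zpow {E : Type*} {g : Equiv.Perm E} {F : E → E} {m : ℤ}
    (hF : ∀ p, F (g p) = (g ^ m) (F p)) (k : ℤ) (p : E) :
    F ((g ^ k) p) = (g ^ (m * k)) (F p) := by
  have hF' : ∀ p, F (g⁻¹ p) = (g ^ (-m)) (F p) := fun p => by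
    have h := hF (g⁻¹ p)
    rw [show g (g⁻¹ p) = p from g.apply_symm_apply p] at h
    rw [h, ← Equiv.Perm.mul_apply, ← zpow_add]
    simp
  induction k using Int.induction_on generalizing p with
  | zero => simp
  | succ k ih =>
    rw [zpow_add_one, Equiv.Perm.mul_apply, ih, hF, ← Equiv.Perm.mul_apply, ← zpow_add]
    congr 2
    ring
  | pred k ih =>
    rw [zpow_sub_one, Equiv.Perm.mul_apply, ih, hF', ← Equiv.Perm.mul_apply, ← zpow_add]
    congr 2
    ring

/-- The compact shell $1\le\|z\|\le|\lambda|$ meets every orbit of $G$. -/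
theorem exists_le_of_G_invariant (hl : 1 < ‖(l : ℂ)‖) {h : Htilde n → ℝ} (hc : Continuous h)
    (hG : ∀ z, h (G n l z) = h z) : ∃ C, ∀ z, h z ≤ C := by
  have hk : ∀ (k : ℤ) z, h ((G n l ^ k) z) = h z := by
    intro k
    induction k using Int.induction_on with
    | zero => simp
    | succ k ih => intro z; rw [zpow_add_one, Equiv.Perm.mul_apply, ih, hG]
    | pred k ih =>
      intro z
      rw [zpow_sub_one, Equiv.Perm.mul_apply, ih, ← hG]
      exact congrArg h ((G n l).apply_symm_apply z)
  set K : Set (Fin n → ℂ) := Metric.closedBall 0 ‖(l : ℂ)‖ ∩ (Metric.ball 0 1)ᶜ with hK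
  have hKc : IsCompact K := (isCompact_closedBall _ _).inter_right Metric.isOpen_ball.isClosed_compl
  have hK0 : ∀ z ∈ K, z ≠ 0 := by
    rintro z ⟨-, hz⟩ rfl
    exact hz (by simp)
  have hKc' : IsCompact ((↑) ⁻¹' K : Set (Htilde n)) :=
    Topology.IsEmbedding.subtypeVal.isInducing.isCompact_preimage' hKc
      fun z hz => ⟨⟨z, hK0 z hz⟩, rfl⟩
  obtain ⟨C, hC⟩ := hKc'.bddAbove_image hc.continuousOn
  refine ⟨C, fun z => ?_⟩
  obtain ⟨k, hk1, hk2⟩ := exists_mem_Ico_zpow (norm_pos_iff.mpr z.2) hl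
  rw [← hk (-k) z]
  refine hC ⟨_, ?_, rfl⟩
  have hl0 : 0 < ‖(l : ℂ)‖ := one_pos.trans hl
  have hn : ‖((G n l ^ (-k)) z).1‖ = ‖(l : ℂ)‖ ^ (-k) * ‖z.1‖ := by
    rw [G_zpow_apply, norm_units_smul, Units.val_zpow_eq_zpow_val, norm_zpow]
  rw [Set.mem_preimage, hK, Set.mem_inter_iff, mem_closedBall_zero_iff, Set.mem_compl_iff,
    mem_ball_zero_iff, not_lt, hn, zpow_neg, inv_mul_eq_div]
  constructor
  · rw [div_le_iff₀ (by positivity), ← zpow_one_add₀ hl0.ne', add_comm]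
    exact hk2.le
  · rwa [le_div_iff₀ (by positivity), one_mul]

/-- The exponents belonging to `F` and to its inverse multiply to $1$. -/
theorem eq_one_or_neg_one_of_comp_G (hn : 1 ≤ n) (hl : 1 < ‖(l : ℂ)‖) {f : AutH n l}
    {F : Equiv.Perm (Htilde n)} (hF : Continuous F) (hF' : Continuous F.symm)
    (hFf : ∀ p, (projH (F p) : H n l) = f.1 (projH p))
    (hFf' : ∀ p, (projH (F.symm p) : H n l) = f.1.symm (projH p)) :
    (∀ p, F (G n l p) = G n l (F p)) ∨ ∀ p, F (G n l p) = (G n l)⁻¹ (F p) := by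
  have := connectedSpace_Htilde hn
  have hG := isWandering_G (n := n) hl
  obtain ⟨m, hm⟩ := hG.exists_zpow_comp hF hFf
  obtain ⟨k, hk⟩ := hG.exists_zpow_comp hF' hFf'
  obtain ⟨p⟩ := (inferInstance : Nonempty (Htilde n))
  have h1 : (G n l ^ (1 : ℤ)) p = (G n l ^ (k * m)) p := by
    have h2 := IsWandering.apply_zpow hk m (F p)
    rw [← hm, Equiv.symm_apply_apply, Equiv.symm_apply_apply] at h2
    rw [zpow_one, h2]
  have h3 := hG.zpow_injective h1
  rcases Int.eq_one_or_neg_one_of_mul_eq_one' h3.symm with ⟨-, rfl⟩ | ⟨-, rfl⟩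
  · left
    intro p
    rw [hm, zpow_one]
  · right
    intro p
    rw [hm, zpow_neg_one]

/-- Any `z` outside the complex line spanned by `w` works. On such affine lines a holomorphic
function on $\mathbb{C}^n\setminus\{O\}$ is entire in one variable, so Liouville arguments apply
without extending it across $O$. -/
theorem exists_forall_add_smul_ne_zero (hn : 2 ≤ n) (w : Fin n → ℂ) :
    ∃ z : Fin n → ℂ, ∀ t : ℂ, z + t • w ≠ 0 := by
  have h1 : Submodule.span ℂ {w} ≠ ⊤ := by
    intro h
    have h2 : Module.finrank ℂ (Submodule.span ℂ {w}) ≤ 1 := by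
      simpa using finrank_span_le_card (R := ℂ) ({w} : Set (Fin n → ℂ))
    rw [h, finrank_top, Module.finrank_fin_fun] at h2
    omega
  obtain ⟨z, -, hz⟩ := SetLike.exists_of_lt h1.lt_top
  refine ⟨z, fun t ht => hz ?_⟩
  rw [eq_neg_of_add_eq_zero_left ht]
  exact neg_mem (Submodule.smul_mem _ _ (Submodule.mem_span_singleton_self w))

theorem differentiable_line {F : Htilde n → Htilde n}
    (hd : ∀ z ≠ 0, DifferentiableAt ℂ (extH F) z) {z w : Fin n → ℂ}
    (h : ∀ t : ℂ, z + t • w ≠ 0) : Differentiable ℂ fun t : ℂ => extH F (z + t • w) := by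
  intro t
  have h1 : Differentiable ℂ fun t : ℂ => z + t • w := by fun_prop
  exact (hd _ (h t)).comp t (h1 t)

theorem norm_G (z : Htilde n) : ‖(G n l z).1‖ = ‖(l : ℂ)‖ * ‖z.1‖ :=
  norm_units_smul l z.1

theorem norm_G_inv (z : Htilde n) : ‖((G n l)⁻¹ z).1‖ = ‖(l : ℂ)‖⁻¹ * ‖z.1‖ := by
  refine (norm_units_smul l⁻¹ z.1).trans ?_
  rw [Units.val_inv_eq_inv_val, norm_inv]

/-- Under this relation $\|F(z)\|\|z\|$ is $G$-invariant, hence bounded. On a complex line missing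
$O$ the map is then entire and tends to $0$ at infinity, so it vanishes, although $F$ avoids $O$. -/
theorem not_comp_G_eq_inv (hn : 2 ≤ n) (hl : 1 < ‖(l : ℂ)‖) {F : Htilde n → Htilde n}
    (hF : Continuous F) (hd : ∀ z ≠ 0, DifferentiableAt ℂ (extH F) z) :
    ¬ ∀ p, F (G n l p) = (G n l)⁻¹ (F p) := by
  intro h
  have hl0 : 0 < ‖(l : ℂ)‖ := one_pos.trans hl
  obtain ⟨C, hC⟩ := exists_le_of_G_invariant hl (h := fun z => ‖(F z).1‖ * ‖z.1‖) (by fun_prop)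
    (fun z => by
      rw [h, norm_G, norm_G_inv]
      field_simp)
  obtain ⟨w, hw⟩ := (isConnected_compl_zero (n := n) (by omega) 0).nonempty
  obtain ⟨z, hz⟩ := exists_forall_add_smul_ne_zero hn w
  have hw0 : 0 < ‖w‖ := norm_pos_iff.mpr hw
  have htend : Filter.Tendsto (fun t : ℂ => ‖z + t • w‖) (Filter.cocompact ℂ) Filter.atTop := by
    refine Filter.tendsto_atTop_mono (fun t => ?_) (Filter.tendsto_atTop_add_const_right _ (-‖z‖)
      ((tendsto_norm_cocompact_atTop (E := ℂ)).atTop_mul_const hw0))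
    have h1 := norm_sub_le (z + t • w) z
    rw [add_sub_cancel_left, norm_smul] at h1
    linarith
  have h0 := (differentiable_line hd hz).apply_eq_of_tendsto_cocompact (c := 0) 0 (by
    rw [tendsto_zero_iff_norm_tendsto_zero]
    refine squeeze_zero (fun _ => norm_nonneg _) (fun t => ?_) (htend.const_div_atTop C)
    rw [le_div_iff₀ (norm_pos_iff.mpr (hz t)), extH_of_ne F (hz t)]
    exact hC ⟨_, hz t⟩)
  rw [extH_of_ne F (hz 0)] at h0
  exact (F _).2 h0

theorem extH_units_smul {F : Htilde n → Htilde n} (hG : ∀ p, F (G n l p) = G n l (F p))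
    (z : Fin n → ℂ) : extH F (l • z) = l • extH F z := by
  by_cases hz : z = 0
  · rw [hz, smul_zero, extH_zero, smul_zero]
  · rw [extH_of_ne F hz, ← show (G n l (F ⟨z, hz⟩)).1 = l • (F ⟨z, hz⟩).1 from rfl, ← hG,
      ← extH_coe]
    rfl

theorem extH_units_pow_smul {F : Htilde n → Htilde n} (hG : ∀ p, F (G n l p) = G n l (F p))
    (k : ℕ) (z : Fin n → ℂ) : extH F (l ^ k • z) = l ^ k • extH F z := by
  induction k with
  | zero => simp
  | succ k ih => rw [pow_succ', mul_smul, extH_units_smul hG, ih, mul_smul]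

theorem tendsto_inv_pow_smul (hl : 1 < ‖(l : ℂ)‖) (z : Fin n → ℂ) :
    Filter.Tendsto (fun k : ℕ => l⁻¹ ^ k • z) Filter.atTop (𝓝 0) := by
  have h1 : Filter.Tendsto (fun k : ℕ => ((l : ℂ)⁻¹) ^ k) Filter.atTop (𝓝 0) := by
    apply tendsto_pow_atTop_nhds_zero_of_norm_lt_one
    rw [norm_inv]
    exact inv_lt_one_of_one_lt₀ hl
  have h2 := h1.smul_const z
  rw [zero_smul] at h2
  refine h2.congr fun k => ?_
  rw [Units.smul_def, Units.val_pow_eq_pow_val, Units.val_inv_eq_inv_val]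

/-- The $G$-invariant function $\|F(z)\|/\|z\|$ is bounded, so $F$ is affine on the line, with some
slope $c$. Homogeneity gives $F(\lambda^{-k}z+w)=\lambda^{-k}F(z)+c$, and $k\to\infty$ identifies
$c$ with $F(w)$ by continuity at $w\ne0$. -/
theorem extH_add_smul (hl : 1 < ‖(l : ℂ)‖) {F : Htilde n → Htilde n}
    (hF : Continuous F) (hd : ∀ z ≠ 0, DifferentiableAt ℂ (extH F) z)
    (hG : ∀ p, F (G n l p) = G n l (F p)) {z w : Fin n → ℂ} (hw : w ≠ 0)
    (h : ∀ t : ℂ, z + t • w ≠ 0) (t : ℂ) :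
    extH F (z + t • w) = extH F z + t • extH F w := by
  have hl0 : 0 < ‖(l : ℂ)‖ := one_pos.trans hl
  obtain ⟨C, hC⟩ := exists_le_of_G_invariant hl (h := fun z => ‖(F z).1‖ / ‖z.1‖) (by
      refine Continuous.div (by fun_prop) (by fun_prop) fun z => (norm_pos_iff.mpr z.2).ne')
    (fun z => by
      rw [hG, norm_G, norm_G, mul_div_mul_left _ _ hl0.ne'])
  have hC0 : 0 ≤ C := (div_nonneg (norm_nonneg _) (norm_nonneg _)).trans (hC ⟨w, hw⟩)
  obtain ⟨c, hc⟩ := exists_affine_of_norm_le (differentiable_line hd h)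
    (C := C * (‖z‖ + ‖w‖)) (fun t => by
      have h1 := hC ⟨_, h t⟩
      rw [div_le_iff₀ (norm_pos_iff.mpr (h t)), ← extH_of_ne F (h t)] at h1
      refine h1.trans ?_
      rw [mul_assoc]
      refine mul_le_mul_of_nonneg_left ((norm_add_le _ _).trans ?_) hC0
      rw [norm_smul]
      nlinarith [norm_nonneg t, norm_nonneg z, norm_nonneg w,
        mul_nonneg (norm_nonneg t) (norm_nonneg z)])
  simp only [zero_smul, add_zero] at hc
  have h2 : Filter.Tendsto (fun k : ℕ => extH F (l⁻¹ ^ k • z + w)) Filter.atTop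
      (𝓝 (extH F w)) := by
    refine (hd w hw).continuousAt.tendsto.comp ?_
    simpa using (tendsto_inv_pow_smul hl z).add_const w
  have h3 : Filter.Tendsto (fun k : ℕ => l⁻¹ ^ k • extH F z + c) Filter.atTop (𝓝 c) := by
    simpa using (tendsto_inv_pow_smul hl (extH F z)).add_const c
  have h4 : extH F w = c := by
    refine tendsto_nhds_unique h2 (h3.congr fun k => ?_)
    -- Evaluation at the parameter $\lambda^k$, whose point on the line is
    -- $\lambda^k(\lambda^{-k}z+w)$.
    have h5 := hc ((l : ℂ) ^ k)
    have h6 : z + (l : ℂ) ^ k • w = l ^ k • (l⁻¹ ^ k • z + w) := by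
      rw [smul_add, smul_smul, ← mul_pow, mul_inv_cancel, one_pow, one_smul, Units.smul_def,
        Units.val_pow_eq_pow_val]
    rw [h6, extH_units_pow_smul hG] at h5
    have h7 := congrArg (fun v => l⁻¹ ^ k • v) h5
    simp only [smul_add, smul_smul, ← mul_pow, inv_mul_cancel, one_pow, one_smul] at h7
    have h8 : (l : ℂ) ^ k • c = l ^ k • c := by rw [Units.smul_def, Units.val_pow_eq_pow_val]
    rw [h7, h8, smul_smul, ← mul_pow, inv_mul_cancel, one_pow, one_smul]
  rw [hc, h4]

/-- Homogeneity results from writing one point $z+tw$ both with direction $w$ at time $t$ and with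
direction $tw$ at time $1$. Additivity is direct unless the line meets $O$; then $z$ is a multiple
of $w$ and homogeneity suffices. -/
theorem isLinearMap_extH (hn : 2 ≤ n) (hl : 1 < ‖(l : ℂ)‖) {F : Htilde n → Htilde n}
    (hF : Continuous F) (hd : ∀ z ≠ 0, DifferentiableAt ℂ (extH F) z)
    (hG : ∀ p, F (G n l p) = G n l (F p)) : IsLinearMap ℂ (extH F) := by
  have hsmul : ∀ (t : ℂ) w, extH F (t • w) = t • extH F w := by
    intro t w
    by_cases hw : w = 0
    · rw [hw, smul_zero, extH_zero, smul_zero]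
    by_cases ht : t = 0
    · rw [ht, zero_smul, extH_zero, zero_smul]
    obtain ⟨z, hz⟩ := exists_forall_add_smul_ne_zero hn w
    have h1 := extH_add_smul hl hF hd hG hw hz t
    have h2 := extH_add_smul hl hF hd hG (smul_ne_zero ht hw) (z := z) (fun s => by
      rw [smul_smul]
      exact hz _) 1
    rw [one_smul, one_smul, h1] at h2
    exact (add_left_cancel h2).symm
  refine ⟨fun z w => ?_, hsmul⟩
  by_cases hw : w = 0
  · rw [hw, add_zero, extH_zero, add_zero]
  by_cases h : ∀ t : ℂ, z + t • w ≠ 0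
  · simpa using extH_add_smul hl hF hd hG hw h 1
  · push Not at h
    obtain ⟨t, ht⟩ := h
    obtain rfl : z = -t • w := by rw [neg_smul, eq_neg_of_add_eq_zero_left ht]
    rw [hsmul, show -t • w + w = (-t + 1) • w by rw [add_smul, one_smul], hsmul, add_smul, one_smul]

/-! ### Linear automorphisms -/

theorem gl_mulVec_ne_zero (A : GL (Fin n) ℂ) {z : Fin n → ℂ} (hz : z ≠ 0) :
    (A : Matrix (Fin n) (Fin n) ℂ) *ᵥ z ≠ 0 := by
  intro h
  refine hz ?_
  have h1 := congrArg (fun v => ((A⁻¹ : GL (Fin n) ℂ) : Matrix (Fin n) (Fin n) ℂ) *ᵥ v) h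
  simp only [Matrix.mulVec_mulVec, Matrix.mulVec_zero] at h1
  rwa [← Units.val_mul, inv_mul_cancel, Units.val_one, Matrix.one_mulVec] at h1

theorem gl_prod_ne_zero (A : GL (Fin n) ℂ) (p : Rtilde n) :
    (((A : Matrix (Fin n) (Fin n) ℂ) *ᵥ p.1.1, p.1.2) : (Fin n → ℂ) × ℝ≥0) ≠ 0 := by
  intro h
  refine p.2 (Prod.ext ?_ (show p.1.2 = 0 from congrArg Prod.snd h))
  by_contra h0
  exact gl_mulVec_ne_zero A h0 (congrArg Prod.fst h)

/-- The action of `GL(n,ℂ)` on `ℂⁿ \ {O}`. -/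
def glPermH (n : ℕ) : GL (Fin n) ℂ →* Equiv.Perm (Htilde n) :=
  MonoidHom.toHomPerm
    { toFun := fun A z => ⟨(A : Matrix (Fin n) (Fin n) ℂ) *ᵥ z.1, gl_mulVec_ne_zero A z.2⟩
      map_one' := funext fun z => Subtype.ext (Matrix.one_mulVec z.1)
      map_mul' := fun _ _ => funext fun z => Subtype.ext (Matrix.mulVec_mulVec z.1 _ _).symm }

/-- The action of `GL(n,ℂ)` on `ℂⁿ × [0,∞) \ {(O,0)}` through the first factor. -/
def glPermR (n : ℕ) : GL (Fin n) ℂ →* Equiv.Perm (Rtilde n) :=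
  MonoidHom.toHomPerm
    { toFun := fun A p => ⟨((A : Matrix (Fin n) (Fin n) ℂ) *ᵥ p.1.1, p.1.2), gl_prod_ne_zero A p⟩
      map_one' := funext fun p => Subtype.ext (Prod.ext (Matrix.one_mulVec p.1.1) rfl)
      map_mul' := fun _ _ => funext fun p =>
        Subtype.ext (Prod.ext (Matrix.mulVec_mulVec p.1.1 _ _).symm rfl) }

theorem glPermH_apply (A : GL (Fin n) ℂ) (z : Htilde n) :
    (glPermH n A z).1 = (A : Matrix (Fin n) (Fin n) ℂ) *ᵥ z.1 := rfl

theorem mulVec_units_smul (A : GL (Fin n) ℂ) (z : Fin n → ℂ) :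
    (A : Matrix (Fin n) (Fin n) ℂ) *ᵥ (l • z) = l • ((A : Matrix (Fin n) (Fin n) ℂ) *ᵥ z) := by
  rw [Units.smul_def, Units.smul_def, Matrix.mulVec_smul]

theorem glPermH_mem_centralizer (l : ℂˣ) (A : GL (Fin n) ℂ) :
    glPermH n A ∈ Subgroup.centralizer {G n l} := by
  rw [Subgroup.mem_centralizer_singleton_iff]
  exact Equiv.ext fun z => Subtype.ext (mulVec_units_smul A z.1)

theorem glPermR_mem_centralizer (l : ℂˣ) (φ : DiffHalf) (A : GL (Fin n) ℂ) :
    glPermR n A ∈ Subgroup.centralizer {T n l φ} := by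
  rw [Subgroup.mem_centralizer_singleton_iff]
  exact Equiv.ext fun p => Subtype.ext (Prod.ext (mulVec_units_smul A p.1.1) rfl)

/-- The permutations `[z] ↦ [Az]` of `H`. -/
def glQuotH (n : ℕ) (l : ℂˣ) : GL (Fin n) ℂ →* Equiv.Perm (H n l) :=
  (quotientPerm (G n l)).comp ((glPermH n).codRestrict _ (glPermH_mem_centralizer l))

/-- The permutations `[z,x] ↦ [Az,x]` of `R`. -/
def glQuotR (n : ℕ) (l : ℂˣ) (φ : DiffHalf) : GL (Fin n) ℂ →* Equiv.Perm (R n l φ) :=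
  (quotientPerm (T n l φ)).comp ((glPermR n).codRestrict _ (glPermR_mem_centralizer l φ))

theorem isHolo_glQuotH (A : GL (Fin n) ℂ) : IsHolo (glQuotH n l A) := fun _ =>
  ⟨Set.univ, fun z => (A : Matrix (Fin n) (Fin n) ℂ) *ᵥ z, isOpen_univ, trivial,
    (LinearMap.toContinuousLinearMap (Matrix.mulVecLin
      (A : Matrix (Fin n) (Fin n) ℂ))).differentiable.differentiableOn,
    fun q _ => ⟨glPermH n A q, rfl, rfl⟩⟩

theorem smoothHalf_id : SmoothHalf (fun x => x) :=
  contDiffOn_id.congr (fun x hx => Real.coe_toNNReal x hx)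

theorem isLeafHolo_glQuotR (A : GL (Fin n) ℂ) : IsLeafHolo (glQuotR n l φ A) := by
  set L := LinearMap.toContinuousLinearMap (Matrix.mulVecLin (A : Matrix (Fin n) (Fin n) ℂ))
  refine isLeafHolo_quotientPerm _ (M := fun y => L y.1) smoothHalf_id ?_ ?_ (fun p => rfl)
  · exact ((L.restrictScalars ℝ).contDiff.comp contDiff_fst).contDiffOn
  · exact fun x => L.differentiable

/-- The homomorphism `GL(n,ℂ) → Aut H`. -/
def glAutH (n : ℕ) (l : ℂˣ) : GL (Fin n) ℂ →* AutH n l :=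
  (glQuotH n l).codRestrict (AutH n l) fun A => ⟨isHolo_glQuotH A, by
    rw [show (glQuotH n l A).symm = glQuotH n l A⁻¹ from (map_inv (glQuotH n l) A).symm]
    exact isHolo_glQuotH A⁻¹⟩

/-- The homomorphism `GL(n,ℂ) → Aut R`. -/
def glAutR (n : ℕ) (l : ℂˣ) (φ : DiffHalf) : GL (Fin n) ℂ →* AutR n l φ :=
  (glQuotR n l φ).codRestrict (AutR n l φ) fun A => ⟨isLeafHolo_glQuotR A, by
    rw [show (glQuotR n l φ A).symm = glQuotR n l φ A⁻¹ from (map_inv (glQuotR n l φ) A).symm]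
    exact isLeafHolo_glQuotR A⁻¹⟩

theorem surjective_glAutH (hn : 2 ≤ n) (hl : 1 < ‖(l : ℂ)‖) :
    Function.Surjective (glAutH n l) := by
  intro f
  obtain ⟨F, hF, hF', hd, hFf, hFf'⟩ := exists_perm_lift_H hn hl f
  have hG := (eq_one_or_neg_one_of_comp_G (by omega) hl hF hF' hFf hFf').resolve_right
    (not_comp_G_eq_inv hn hl hF hd)
  set L : (Fin n → ℂ) →ₗ[ℂ] (Fin n → ℂ) := (isLinearMap_extH hn hl hF hd hG).mk' with hL
  set A := LinearMap.toMatrix' L with hA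
  have hAL : ∀ z, A *ᵥ z = extH F z := fun z => by
    rw [hA, LinearMap.toMatrix'_mulVec]
    rfl
  -- The kernel is trivial because $F$ never takes the value $O$.
  have hinj : Function.Injective A.mulVec := by
    rw [← Matrix.coe_mulVecLin, injective_iff_map_eq_zero]
    intro z hz
    by_contra h0
    rw [Matrix.mulVecLin_apply, hAL, extH_of_ne F h0] at hz
    exact (F _).2 hz
  refine ⟨(Matrix.mulVec_injective_iff_isUnit.mp hinj).unit, ?_⟩
  apply Subtype.ext
  refine Equiv.ext fun h => ?_
  obtain ⟨z, rfl⟩ := Quotient.exists_rep h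
  refine Eq.trans ?_ (hFf z)
  show projH (glPermH n _ z) = projH (F z)
  congr 1
  apply Subtype.ext
  rw [glPermH_apply, IsUnit.unit_spec, hAL, extH_coe]

theorem glPermH_injective : Function.Injective (glPermH n) := by
  intro A B h
  apply Units.ext
  apply Matrix.mulVec_injective
  funext z
  by_cases hz : z = 0
  · simp [hz]
  · exact congrArg Subtype.val (congrArg (fun F : Equiv.Perm (Htilde n) => F ⟨z, hz⟩) h)

theorem glPermH_scalar : glPermH n (Matrix.GeneralLinearGroup.scalar (Fin n) l) = G n l := by
  refine Equiv.ext fun z => Subtype.ext ?_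
  rw [glPermH_apply]
  show _ = l • z.1
  rw [Units.smul_def]
  funext i
  simp [Matrix.mulVec_diagonal, Matrix.GeneralLinearGroup.scalar]

/-- If $A$ acts trivially on $H$, then $z\mapsto Az$ and the identity lift the same map, so $A$ is a
power of $G$. -/
theorem ker_glAutH (hn : 1 ≤ n) (hl : 1 < ‖(l : ℂ)‖) :
    (glAutH n l).ker = scalarPowers n l := by
  have := connectedSpace_Htilde hn
  have hc : ∀ A, Continuous (glPermH n A) := fun A => by
    refine Continuous.subtype_mk ?_ _
    exact continuous_const.matrix_mulVec continuous_subtype_val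
  ext A
  rw [MonoidHom.mem_ker, Subgroup.mem_zpowers_iff]
  constructor
  · intro h
    obtain ⟨k, hk⟩ := (isWandering_G (n := n) hl).exists_zpow_eq_of_lifts
      continuous_id (hc A) (fun z => by
        have h1 : glQuotH n l A = 1 := congrArg Subtype.val h
        exact (congrArg (fun F : Equiv.Perm (H n l) => F (projH z)) h1).symm)
    refine ⟨k, glPermH_injective ?_⟩
    rw [map_zpow, glPermH_scalar]
    exact Equiv.ext hk
  · rintro ⟨k, rfl⟩
    apply Subtype.ext
    refine Equiv.ext fun h => ?_
    obtain ⟨z, rfl⟩ := Quotient.exists_rep h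
    show projH (glPermH n _ z) = projH z
    rw [map_zpow, glPermH_scalar]
    exact (projH_eq_iff.mpr ⟨k, rfl⟩).symm

/-- The isomorphism `GL(n,ℂ) / ⟨λ Iₙ⟩ ≅ Aut H`. -/
def glEquivAutH (hn : 2 ≤ n) (hl : 1 < ‖(l : ℂ)‖) :
    (GL (Fin n) ℂ ⧸ scalarPowers n l) ≃* AutH n l :=
  (QuotientGroup.quotientMulEquivOfEq (ker_glAutH (by omega) hl).symm).trans
    (QuotientGroup.quotientKerEquivOfSurjective (glAutH n l) (surjective_glAutH hn hl))

theorem glEquivAutH_mk (hn : 2 ≤ n) (hl : 1 < ‖(l : ℂ)‖) (A : GL (Fin n) ℂ) :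
    glEquivAutH hn hl (QuotientGroup.mk A) = glAutH n l A := rfl

theorem restrictHom_glAutR (hn : 1 ≤ n) (hl : 1 < ‖(l : ℂ)‖) (hφ : ∀ x : ℝ≥0, 0 < x → x < φ.1 x)
    (A : GL (Fin n) ℂ) : restrictHom hn hl hφ (glAutR n l φ A) = glAutH n l A := by
  apply Subtype.ext
  refine Equiv.ext fun h => ?_
  apply bdry_injective (φ := φ)
  refine (bdry_restrictPerm hn hl hφ (glAutR n l φ A) h).trans ?_
  obtain ⟨z, rfl⟩ := Quotient.exists_rep h
  rfl

theorem surjective_restrictHom (hn : 2 ≤ n) (hl : 1 < ‖(l : ℂ)‖)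
    (hφ : ∀ x : ℝ≥0, 0 < x → x < φ.1 x) :
    Function.Surjective (restrictHom (n := n) (l := l) (by omega) hl hφ) := by
  intro f
  obtain ⟨A, rfl⟩ := surjective_glAutH hn hl f
  exact ⟨glAutR n l φ A, restrictHom_glAutR _ hl hφ A⟩

/-! ### Flat functions -/

/-- The function `u` and its derivatives up to order `k` tend to `0` at `0` from the right. -/
def FlatTo : ℕ → (ℝ → ℂ) → Prop
  | 0, u => Filter.Tendsto u (𝓝[>] 0) (𝓝 0)
  | k + 1, u => Filter.Tendsto u (𝓝[>] 0) (𝓝 0) ∧ FlatTo k (deriv u)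

theorem FlatTo.tendsto {k : ℕ} {u : ℝ → ℂ} (h : FlatTo k u) :
    Filter.Tendsto u (𝓝[>] 0) (𝓝 0) := by
  cases k with
  | zero => exact h
  | succ k => exact h.1

theorem FlatTo.of_succ {k : ℕ} {u : ℝ → ℂ} (h : FlatTo (k + 1) u) : FlatTo k u := by
  induction k generalizing u with
  | zero => exact h.1
  | succ k ih => exact ⟨h.1, ih h.2⟩

theorem FlatTo.congr {k : ℕ} {u v : ℝ → ℂ} (h : FlatTo k u) (huv : Set.EqOn u v (Set.Ioi 0)) :
    FlatTo k v := by
  have ht : Filter.Tendsto v (𝓝[>] 0) (𝓝 0) :=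
    h.tendsto.congr' (Filter.eventuallyEq_of_mem self_mem_nhdsWithin huv)
  induction k generalizing u v with
  | zero => exact ht
  | succ k ih =>
    have hd : Set.EqOn (deriv u) (deriv v) (Set.Ioi 0) := huv.deriv isOpen_Ioi
    refine ⟨ht, ih h.2 hd ?_⟩
    exact h.2.tendsto.congr' (Filter.eventuallyEq_of_mem self_mem_nhdsWithin hd)

theorem differentiableAt_of_contDiffOn_Ioi {u : ℝ → ℂ} (hu : ContDiffOn ℝ ∞ u (Set.Ioi 0)) {x : ℝ}
    (hx : 0 < x) : DifferentiableAt ℝ u x :=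
  (hu.differentiableOn (by simp)).differentiableAt (Ioi_mem_nhds hx)

theorem contDiffOn_Ioi_deriv {u : ℝ → ℂ} (hu : ContDiffOn ℝ ∞ u (Set.Ioi 0)) :
    ContDiffOn ℝ ∞ (deriv u) (Set.Ioi 0) :=
  ((contDiffOn_infty_iff_deriv_of_isOpen isOpen_Ioi).mp hu).2

theorem contDiffOn_Ici_derivWithin {V : Type*} [NormedAddCommGroup V] [NormedSpace ℝ V] {a : ℝ → V}
    (ha : ContDiffOn ℝ ∞ a (Set.Ici 0)) : ContDiffOn ℝ ∞ (derivWithin a (Set.Ici 0)) (Set.Ici 0) :=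
  ((contDiffOn_infty_iff_derivWithin (uniqueDiffOn_Ici 0)).mp ha).2

theorem hasDerivAt_of_contDiffOn_Ici {V : Type*} [NormedAddCommGroup V] [NormedSpace ℝ V]
    {a : ℝ → V} (ha : ContDiffOn ℝ ∞ a (Set.Ici 0)) {x : ℝ} (hx : 0 < x) :
    HasDerivAt a (derivWithin a (Set.Ici 0) x) x :=
  ((ha.differentiableOn (by simp)) x hx.le).hasDerivWithinAt.hasDerivAt (Ici_mem_nhds hx)

theorem FlatTo.add {k : ℕ} {u v : ℝ → ℂ} (hu : ContDiffOn ℝ ∞ u (Set.Ioi 0))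
    (hv : ContDiffOn ℝ ∞ v (Set.Ioi 0)) (h1 : FlatTo k u) (h2 : FlatTo k v) :
    FlatTo k (fun x => u x + v x) := by
  have ht : Filter.Tendsto (fun x => u x + v x) (𝓝[>] 0) (𝓝 0) := by
    simpa using h1.tendsto.add h2.tendsto
  induction k generalizing u v with
  | zero => exact ht
  | succ k ih =>
    refine ⟨ht, (ih (contDiffOn_Ioi_deriv hu) (contDiffOn_Ioi_deriv hv) h1.2 h2.2 ?_).congr ?_⟩
    · simpa using h1.2.tendsto.add h2.2.tendsto
    · intro x hx
      exact (deriv_fun_add (differentiableAt_of_contDiffOn_Ioi hu hx)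
        (differentiableAt_of_contDiffOn_Ioi hv hx)).symm

/-- By the Leibniz rule: the factor $a$ is smooth up to $0$, so it and its derivatives have finite
limits there. -/
theorem FlatTo.mul {k : ℕ} {a u : ℝ → ℂ} (ha : ContDiffOn ℝ ∞ a (Set.Ici 0))
    (hu : ContDiffOn ℝ ∞ u (Set.Ioi 0)) (h : FlatTo k u) : FlatTo k (fun x => a x * u x) := by
  have hlim : ∀ {b v : ℝ → ℂ}, ContDiffOn ℝ ∞ b (Set.Ici 0) → Filter.Tendsto v (𝓝[>] 0) (𝓝 0) →
      Filter.Tendsto (fun x => b x * v x) (𝓝[>] 0) (𝓝 0) := by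
    intro b v hb hv
    have h1 : Filter.Tendsto b (𝓝[>] 0) (𝓝 (b 0)) :=
      (hb.continuousOn 0 Set.self_mem_Ici).mono_left (nhdsWithin_mono _ Set.Ioi_subset_Ici_self)
    simpa using h1.mul hv
  induction k generalizing a u with
  | zero => exact hlim ha h
  | succ k ih =>
    refine ⟨hlim ha h.tendsto, ?_⟩
    have ha' := contDiffOn_Ici_derivWithin ha
    have hu' := contDiffOn_Ioi_deriv hu
    refine (FlatTo.add ((ha'.mono Set.Ioi_subset_Ici_self).mul hu)
      ((ha.mono Set.Ioi_subset_Ici_self).mul hu') (ih ha' hu h.of_succ) (ih ha hu' h.2)).congr ?_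
    intro x hx
    exact ((hasDerivAt_of_contDiffOn_Ici ha hx).mul
      (differentiableAt_of_contDiffOn_Ioi hu hx).hasDerivAt).deriv.symm

/-! ### Compositions with a diffeomorphism of the half line -/

theorem onReal_pos (φ : DiffHalf) {x : ℝ} (hx : 0 < x) : 0 < onReal φ.1 x := by
  have := map_pos_half φ (x := x.toNNReal) (by simpa using hx)
  exact_mod_cast this

theorem contDiffOn_onReal (φ : DiffHalf) : ContDiffOn ℝ ∞ (onReal φ.1) (Set.Ici 0) := φ.2.1

theorem onReal_zero (φ : DiffHalf) : onReal φ.1 0 = 0 := by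
  simp [onReal, map_zero_half]

theorem tendsto_onReal (φ : DiffHalf) : Filter.Tendsto (onReal φ.1) (𝓝[>] 0) (𝓝[>] 0) := by
  refine tendsto_nhdsWithin_iff.mpr ⟨?_, ?_⟩
  · have h := ((contDiffOn_onReal φ).continuousOn 0 Set.self_mem_Ici)
    rw [ContinuousWithinAt, onReal_zero] at h
    exact h.mono_left (nhdsWithin_mono _ Set.Ioi_subset_Ici_self)
  · filter_upwards [self_mem_nhdsWithin] with x hx
    exact onReal_pos φ hx

theorem contDiffOn_comp_onReal (φ : DiffHalf) {u : ℝ → ℂ} (hu : ContDiffOn ℝ ∞ u (Set.Ioi 0)) :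
    ContDiffOn ℝ ∞ (fun x => u (onReal φ.1 x)) (Set.Ioi 0) :=
  hu.comp ((contDiffOn_onReal φ).mono Set.Ioi_subset_Ici_self) fun _ hx => onReal_pos φ hx

/-- The derivative of `φ` on `[0,∞)`, as a complex valued function. -/
def slope (φ : DiffHalf) (x : ℝ) : ℂ := ((derivWithin (onReal φ.1) (Set.Ici 0) x : ℝ) : ℂ)

theorem contDiffOn_slope (φ : DiffHalf) : ContDiffOn ℝ ∞ (slope φ) (Set.Ici 0) :=
  Complex.ofRealCLM.contDiff.comp_contDiffOn (contDiffOn_Ici_derivWithin (contDiffOn_onReal φ))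

theorem hasDerivAt_comp_onReal (φ : DiffHalf) {u : ℝ → ℂ} (hu : ContDiffOn ℝ ∞ u (Set.Ioi 0))
    {x : ℝ} (hx : 0 < x) :
    HasDerivAt (fun x => u (onReal φ.1 x)) (slope φ x * deriv u (onReal φ.1 x)) x := by
  have h := HasDerivAt.scomp x
    (differentiableAt_of_contDiffOn_Ioi hu (onReal_pos φ hx)).hasDerivAt
    (hasDerivAt_of_contDiffOn_Ici (contDiffOn_onReal φ) hx)
  rwa [Complex.real_smul] at h

theorem FlatTo.comp_onReal (φ : DiffHalf) {k : ℕ} {u : ℝ → ℂ} (hu : ContDiffOn ℝ ∞ u (Set.Ioi 0))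
    (h : FlatTo k u) : FlatTo k (fun x => u (onReal φ.1 x)) := by
  induction k generalizing u with
  | zero => exact h.tendsto.comp (tendsto_onReal φ)
  | succ k ih =>
    refine ⟨h.tendsto.comp (tendsto_onReal φ), ?_⟩
    have hu' := contDiffOn_Ioi_deriv hu
    refine ((ih hu' h.2).mul (contDiffOn_slope φ) (contDiffOn_comp_onReal φ hu')).congr ?_
    intro x hx
    exact (hasDerivAt_comp_onReal φ hu hx).deriv.symm

/-! ### The functional equation -/

theorem inv_le_half (hφ : ∀ x : ℝ≥0, 0 < x → x < φ.1 x) (y : ℝ≥0) : φ⁻¹.1 y ≤ y := by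
  rcases eq_or_lt_of_le (zero_le (a := y)) with h | h
  · rw [← h, map_zero_half]
  · exact (inv_lt_half hφ h).le

theorem iterate_inv_le (hφ : ∀ x : ℝ≥0, 0 < x → x < φ.1 x) (k : ℕ) (y : ℝ≥0) :
    (φ⁻¹.1)^[k] y ≤ y := by
  induction k with
  | zero => exact le_rfl
  | succ k ih =>
    rw [Function.iterate_succ_apply']
    exact (inv_le_half hφ _).trans ih

theorem tendsto_iterate_inv (hφ : ∀ x : ℝ≥0, 0 < x → x < φ.1 x) (x : ℝ≥0) :
    Filter.Tendsto (fun k => (φ⁻¹.1)^[k] x) Filter.atTop (𝓝 0) := by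
  have hanti : Antitone fun k => (φ⁻¹.1)^[k] x := antitone_nat_of_succ_le fun k => by
    rw [Function.iterate_succ_apply']
    exact inv_le_half hφ _
  have hlim := tendsto_atTop_ciInf hanti (OrderBot.bddBelow _)
  set a := ⨅ k, (φ⁻¹.1)^[k] x with ha
  have hfix : φ⁻¹.1 a = a := isFixedPt_of_tendsto_iterate hlim φ⁻¹.2.1.continuous.continuousAt
  rcases eq_or_lt_of_le (zero_le (a := a)) with h | h
  · rwa [← h] at hlim
  · exact absurd hfix (inv_lt_half hφ h).ne

/-- Near $0$ the equation bounds $|u(x)|$ by $q|u(\varphi(x))|$ plus a small error, with $q<1$.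
Starting from a bound on a fundamental interval $[x_0,\varphi(x_0)]$, each step of $\varphi^{-1}$
towards $0$ multiplies that bound by $q$, while the errors sum to at most $\varepsilon/2$. -/
theorem tendsto_zero_of_functional_eq (hφ : ∀ x : ℝ≥0, 0 < x → x < φ.1 x) {u a g : ℝ → ℂ}
    (hu : ContinuousOn u (Set.Ioi 0)) {a₀ : ℂ} (ha : Filter.Tendsto a (𝓝[>] 0) (𝓝 a₀))
    (ha₀ : ‖a₀‖ < 1) (hg : Filter.Tendsto g (𝓝[>] 0) (𝓝 0))
    (h : ∀ x : ℝ, 0 < x → u x = a x * u (onReal φ.1 x) + g x) :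
    Filter.Tendsto u (𝓝[>] 0) (𝓝 0) := by
  obtain ⟨q, hq0, hq1⟩ := exists_between ha₀
  have hqpos : 0 ≤ q := (norm_nonneg _).trans hq0.le
  rw [Metric.tendsto_nhds]
  intro ε hε
  have h1 : ∀ᶠ x in 𝓝[>] (0 : ℝ), ‖a x‖ < q := ha.norm.eventually (gt_mem_nhds hq0)
  -- With this bound on the error, $\varepsilon/2$ is the fixed point of $s\mapsto
  -- qs+(1-q)\varepsilon/2$, so the additive term in `key` does not grow.
  have h2 : ∀ᶠ x in 𝓝[>] (0 : ℝ), ‖g x‖ < (1 - q) * (ε / 2) := by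
    have := hg.norm
    rw [norm_zero] at this
    exact this.eventually (gt_mem_nhds (mul_pos (sub_pos.mpr hq1) (half_pos hε)))
  obtain ⟨δ, hδ, hδ'⟩ := mem_nhdsGT_iff_exists_Ioo_subset.mp (h1.and h2)
  rw [Set.mem_Ioi] at hδ
  set x₀ : ℝ≥0 := (δ / 2).toNNReal with hx₀
  have hx₀pos : 0 < x₀ := by simpa [hx₀] using hδ
  have hx₀lt : (x₀ : ℝ) < δ := by
    rw [hx₀, Real.coe_toNNReal _ (by linarith)]
    linarith
  have hK : IsCompact (Set.Icc (x₀ : ℝ) (φ.1 x₀ : ℝ)) := isCompact_Icc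
  obtain ⟨M, hM⟩ := (hK.image_of_continuousOn (hu.mono fun x hx =>
    lt_of_lt_of_le (NNReal.coe_pos.mpr hx₀pos) hx.1)).isBounded.exists_norm_le
  set ψ := φ⁻¹.1 with hψ
  have hψφ : ∀ y, ψ (φ.1 y) = y := fun y => φ.1.symm_apply_apply y
  have hφψ : ∀ y, φ.1 (ψ y) = y := fun y => φ.1.apply_symm_apply y
  have hψmono : StrictMono ψ := strictMono_half φ⁻¹
  have hψle : ∀ k y, (ψ^[k]) y ≤ y := iterate_inv_le hφ
  have hpos : ∀ k, 0 < (ψ^[k]) x₀ := fun k => by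
    induction k with
    | zero => exact hx₀pos
    | succ k ih =>
      rw [Function.iterate_succ_apply']
      exact map_pos_half φ⁻¹ ih
  have key : ∀ k : ℕ, ∀ x : ℝ≥0, (ψ^[k]) x₀ ≤ x → x ≤ (ψ^[k]) (φ.1 x₀) →
      ‖u x‖ ≤ q ^ k * M + ε / 2 := by
    intro k
    induction k with
    | zero =>
      intro x hx1 hx2
      have := hM (u x) ⟨x, ⟨NNReal.coe_le_coe.mpr hx1, NNReal.coe_le_coe.mpr hx2⟩, rfl⟩
      rw [pow_zero, one_mul]
      linarith
    | succ k ih =>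
      intro x hx1 hx2
      have hxpos : 0 < x := (hpos _).trans_le hx1
      have hxx : x ≤ x₀ := by
        rw [Function.iterate_succ_apply, hψφ] at hx2
        exact hx2.trans (hψle k x₀)
      have hxδ : (x : ℝ) ∈ Set.Ioo 0 δ := ⟨hxpos, lt_of_le_of_lt (NNReal.coe_le_coe.mpr hxx) hx₀lt⟩
      obtain ⟨hax, hgx⟩ := hδ' hxδ
      rw [Function.iterate_succ_apply'] at hx1 hx2
      have h3 := ih (φ.1 x) (by rw [← hψmono.le_iff_le, hψφ]; exact hx1)
        (by rw [← hψmono.le_iff_le, hψφ]; exact hx2)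
      have h4 : u x = a x * u (φ.1 x : ℝ≥0) + g x := by
        rw [h x hxpos, onReal, Real.toNNReal_coe]
      rw [h4]
      calc ‖a x * u (φ.1 x : ℝ≥0) + g x‖ ≤ ‖a x‖ * ‖u (φ.1 x : ℝ≥0)‖ + ‖g x‖ := by
            rw [← norm_mul]
            exact norm_add_le _ _
        _ ≤ q * (q ^ k * M + ε / 2) + (1 - q) * (ε / 2) :=
            add_le_add (mul_le_mul hax.le h3 (norm_nonneg _) hqpos) hgx.le
        _ = q ^ (k + 1) * M + ε / 2 := by ring
  have hqM : Filter.Tendsto (fun k : ℕ => q ^ k * M) Filter.atTop (𝓝 0) := by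
    simpa using (tendsto_pow_atTop_nhds_zero_of_lt_one hqpos hq1).mul_const M
  obtain ⟨N, hN⟩ := Filter.eventually_atTop.mp (hqM.eventually (gt_mem_nhds (half_pos hε)))
  have hNpos : (0 : ℝ) < (ψ^[N]) x₀ := hpos N
  filter_upwards [Ioo_mem_nhdsGT hNpos] with x hx
  obtain ⟨y, rfl⟩ : ∃ y : ℝ≥0, (y : ℝ) = x := ⟨⟨x, hx.1.le⟩, rfl⟩
  have hy : 0 < y := hx.1
  have hyN : y < (ψ^[N]) x₀ := hx.2
  have hex : ∃ k, (ψ^[k]) x₀ ≤ y :=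
    ((tendsto_iterate_inv hφ x₀).eventually (gt_mem_nhds hy)).exists.imp fun _ h => h.le
  classical
  -- The least such $k$ places $y$ in the $k$-th translate
  -- $[\varphi^{-k}(x_0),\varphi^{-k}(\varphi(x_0))]$. Closeness of $y$ to $0$ makes $k>N$.
  set k := Nat.find hex with hk
  have hk1 : (ψ^[k]) x₀ ≤ y := Nat.find_spec hex
  have hkN : N < k := by
    by_contra hcon
    push Not at hcon
    refine absurd (hk1.trans_lt hyN) (not_lt.mpr ?_)
    obtain ⟨j, hj⟩ := Nat.exists_eq_add_of_le' hcon
    rw [hj, Function.iterate_add_apply]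
    exact hψle _ _
  obtain ⟨j, hj⟩ : ∃ j, k = j + 1 := ⟨k - 1, by omega⟩
  have hj2 : y < (ψ^[j]) x₀ := not_le.mp (Nat.find_min hex (by omega))
  rw [dist_zero_right]
  refine (key k y hk1 ?_).trans_lt ?_
  · rw [hj, Function.iterate_succ_apply, hψφ]
    exact hj2.le
  · have := hN k hkN.le
    linarith

/-- Differentiation gives $u'=(a\varphi')\,u'\circ\varphi+(a'\,u\circ\varphi+g')$, an equation of
the same type. Its coefficient at $0$ is still $a(0)$ because $\varphi'(0)=1$. -/
theorem flatTo_of_functional_eq (hφ : ∀ x : ℝ≥0, 0 < x → x < φ.1 x) (hs : slope φ 0 = 1) {k : ℕ}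
    {u a g : ℝ → ℂ} (hu : ContDiffOn ℝ ∞ u (Set.Ioi 0)) (ha : ContDiffOn ℝ ∞ a (Set.Ici 0))
    (ha₀ : ‖a 0‖ < 1) (hg : ContDiffOn ℝ ∞ g (Set.Ioi 0)) (hgk : FlatTo k g)
    (h : ∀ x : ℝ, 0 < x → u x = a x * u (onReal φ.1 x) + g x) : FlatTo k u := by
  have hlim : ∀ {b : ℝ → ℂ}, ContDiffOn ℝ ∞ b (Set.Ici 0) →
      Filter.Tendsto b (𝓝[>] 0) (𝓝 (b 0)) := fun hb =>
    (hb.continuousOn 0 Set.self_mem_Ici).mono_left (nhdsWithin_mono _ Set.Ioi_subset_Ici_self)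
  induction k generalizing u a g with
  | zero => exact tendsto_zero_of_functional_eq hφ hu.continuousOn (hlim ha) ha₀ hgk h
  | succ k ih =>
    refine ⟨tendsto_zero_of_functional_eq hφ hu.continuousOn (hlim ha) ha₀ hgk.tendsto h, ?_⟩
    have hu' := contDiffOn_Ioi_deriv hu
    have hg' := contDiffOn_Ioi_deriv hg
    have ha' := contDiffOn_Ici_derivWithin ha
    -- The induction hypothesis serves twice: here for $u$, to make the new inhomogeneous term flat
    -- to order $k$, and below for $u'$.
    have huk := ih hu ha ha₀ hg hgk.of_succ h
    have huφ := contDiffOn_comp_onReal φ hu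
    have h1 := (ha'.mono Set.Ioi_subset_Ici_self).mul huφ
    refine ih (a := fun x => a x * slope φ x)
      (g := fun x => derivWithin a (Set.Ici 0) x * u (onReal φ.1 x) + deriv g x)
      hu' (ha.mul (contDiffOn_slope φ)) (by rwa [hs, mul_one]) (h1.add hg')
      (FlatTo.add h1 hg' ((huk.comp_onReal φ hu).mul ha' huφ) hgk.2) ?_
    intro x hx
    have h2 : HasDerivAt (fun x => a x * u (onReal φ.1 x) + g x) _ x :=
      ((hasDerivAt_of_contDiffOn_Ici ha hx).mul (hasDerivAt_comp_onReal φ hu hx)).add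
        (differentiableAt_of_contDiffOn_Ioi hg hx).hasDerivAt
    have h3 : deriv u x = deriv (fun x => a x * u (onReal φ.1 x) + g x) x :=
      Set.EqOn.deriv (s := Set.Ioi 0) (fun y hy => h y hy) isOpen_Ioi hx
    rw [h3, h2.deriv]
    ring

/-- Only $x=0$ is delicate. There the right derivative exists and is $0$ because $u$ and $u'$ both
tend to $0$. -/
theorem hasDerivAt_indicator_of_flatTo {u : ℝ → ℂ} (hu : ContDiffOn ℝ ∞ u (Set.Ioi 0))
    (h : FlatTo 1 u) (x : ℝ) :
    HasDerivAt ((Set.Ioi 0).indicator u) ((Set.Ioi 0).indicator (deriv u) x) x := by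
  have heq : Set.EqOn ((Set.Ioi 0).indicator u) u (Set.Ioi 0) := fun y hy =>
    Set.indicator_of_mem hy u
  have hpos : ∀ y : ℝ, 0 < y → HasDerivAt ((Set.Ioi 0).indicator u) (deriv u y) y := fun y hy =>
    (differentiableAt_of_contDiffOn_Ioi hu hy).hasDerivAt.congr_of_eventuallyEq
      (heq.eventuallyEq_of_mem (Ioi_mem_nhds hy))
  rcases lt_trichotomy x 0 with hx | rfl | hx
  · rw [Set.indicator_of_notMem (by simpa using hx.le)]
    refine (hasDerivAt_const x (0 : ℂ)).congr_of_eventuallyEq ?_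
    filter_upwards [gt_mem_nhds hx] with y hy
    exact Set.indicator_of_notMem (by simpa using hy.le) _
  · rw [Set.indicator_of_notMem (by simp), ← hasDerivWithinAt_univ,
      ← Set.Iic_union_Ici (a := (0 : ℝ))]
    refine HasDerivWithinAt.union ?_ ?_
    · refine (hasDerivWithinAt_const 0 _ (0 : ℂ)).congr (fun y hy => ?_) ?_
      · exact Set.indicator_of_notMem (by simpa using hy) _
      · exact Set.indicator_of_notMem (by simp) _
    · refine hasDerivWithinAt_Ici_of_tendsto_deriv (s := Set.Ioi 0)
        (fun y hy => (hpos y hy).differentiableAt.differentiableWithinAt) ?_ self_mem_nhdsWithin ?_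
      · rw [ContinuousWithinAt, Set.indicator_of_notMem (by simp)]
        exact h.1.congr' (Filter.eventuallyEq_of_mem self_mem_nhdsWithin heq.symm)
      · refine h.2.tendsto.congr' (Filter.eventuallyEq_of_mem self_mem_nhdsWithin ?_)
        exact fun y hy => (hpos y hy).deriv.symm
  · rw [Set.indicator_of_mem (by exact hx)]
    exact hpos x hx

/-- Extension by zero commutes with differentiation for flat functions, so the order of smoothness
can be raised inductively. -/
theorem contDiff_of_flatTo {u : ℝ → ℂ} (hu : ContDiffOn ℝ ∞ u (Set.Ioi 0))
    (h : ∀ k, FlatTo k u) : ContDiff ℝ ∞ ((Set.Ioi 0).indicator u) := by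
  rw [contDiff_infty]
  intro m
  induction m generalizing u with
  | zero =>
    have hd : Differentiable ℝ ((Set.Ioi 0).indicator u) := fun x =>
      (hasDerivAt_indicator_of_flatTo hu (h 1) x).differentiableAt
    rw [Nat.cast_zero, contDiff_zero]
    exact hd.continuous
  | succ m ih =>
    have hd := hasDerivAt_indicator_of_flatTo hu (h 1)
    have h1 : deriv ((Set.Ioi 0).indicator u) = (Set.Ioi 0).indicator (deriv u) :=
      funext fun x => (hd x).deriv
    rw [Nat.cast_add, Nat.cast_one, contDiff_succ_iff_deriv]
    refine ⟨fun x => (hd x).differentiableAt, by simp, ?_⟩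
    rw [h1]
    exact ih (contDiffOn_Ioi_deriv hu) (fun k => (h (k + 1)).2)

theorem slope_zero (hφ0 : InfTangentToId φ) : slope φ 0 = 1 := by
  have h1 := hφ0 1
  have hd : DifferentiableWithinAt ℝ (onReal φ.1) (Set.Ici 0) 0 :=
    (contDiffOn_onReal φ).differentiableOn (by simp) 0 Set.self_mem_Ici
  have hu : UniqueDiffWithinAt ℝ (Set.Ici (0 : ℝ)) 0 := uniqueDiffOn_Ici 0 0 Set.self_mem_Ici
  have h2 : HasDerivWithinAt (fun x => onReal φ.1 x - x)
      (derivWithin (onReal φ.1) (Set.Ici 0) 0 - 1) (Set.Ici 0) 0 :=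
    hd.hasDerivWithinAt.sub (hasDerivWithinAt_id (0 : ℝ) _)
  rw [iteratedDerivWithin_one, h2.derivWithin hu] at h1
  rw [slope, sub_eq_zero.mp h1, Complex.ofReal_one]

/-- Solutions of `β(φ(x)) = λ β(x)`, extended by `0`, are smooth. -/
theorem contDiff_extZero (hl : 1 < ‖(l : ℂ)‖) (hφ : ∀ x : ℝ≥0, 0 < x → x < φ.1 x)
    (hφ0 : InfTangentToId φ) (β : ZSol φ l) :
    ContDiff ℝ ∞ (fun x : ℝ => extZero β.1 x.toNNReal) := by
  have hu : ContDiffOn ℝ ∞ (fun x : ℝ => extZero β.1 x.toNNReal) (Set.Ioi 0) := β.2.1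
  have hflat : ∀ k, FlatTo k (fun x : ℝ => extZero β.1 x.toNNReal) := by
    have h0 : ∀ k, FlatTo k (fun _ : ℝ => (0 : ℂ)) := by
      intro k
      induction k with
      | zero => exact tendsto_const_nhds
      | succ k ih => exact ⟨tendsto_const_nhds, by simpa using ih⟩
    intro k
    -- The equation is used in the contracting form $\beta=\lambda^{-1}\,\beta\circ\varphi$, without
    -- inhomogeneous term.
    refine flatTo_of_functional_eq hφ (slope_zero hφ0) (a := fun _ => (l : ℂ)⁻¹) (g := fun _ => 0)
      hu contDiffOn_const ?_ contDiffOn_const (h0 k) ?_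
    · rw [norm_inv]
      exact inv_lt_one_of_one_lt₀ hl
    · intro x hx
      have hx' : 0 < x.toNNReal := by simpa using hx
      have h1 := β.2.2 ⟨x.toNNReal, hx'⟩
      rw [← extZero_pos β.1, ← extZero_pos β.1] at h1
      rw [onReal, Real.toNNReal_coe, add_zero]
      show _ = _ * extZero β.1 (posMap φ ⟨x.toNNReal, hx'⟩).1
      rw [h1, inv_mul_cancel_left₀ l.ne_zero]
  convert contDiff_of_flatTo hu hflat using 1
  funext x
  by_cases hx : 0 < x
  · rw [Set.indicator_of_mem (by exact hx)]
  · rw [Set.indicator_of_notMem (by exact hx), Real.toNNReal_of_nonpos (not_lt.mp hx)]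
    simp [extZero]

/-! ### The action of the semidirect product -/

theorem extZero_zero (β : PosHalf → ℂ) : extZero β 0 = 0 := by
  simp [extZero]

theorem extZero_precomp (η : Zc φ) (β : ZSol φ l) (x : ℝ≥0) :
    extZero (precomp η β).1 x = extZero β.1 (η.1.1 x) := by
  rcases eq_or_lt_of_le (zero_le (a := x)) with h | h
  · rw [← h, map_zero_half, extZero_zero, extZero_zero]
  · rw [show extZero (precomp η β).1 x = _ from extZero_pos _ ⟨x, h⟩]
    exact (extZero_pos β.1 (posMap η.1 ⟨x, h⟩)).symm

theorem extZero_map (β : ZSol φ l) (x : ℝ≥0) :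
    extZero β.1 (φ.1 x) = l * extZero β.1 x := by
  rcases eq_or_lt_of_le (zero_le (a := x)) with h | h
  · rw [← h, map_zero_half, extZero_zero, mul_zero]
  · rw [show extZero β.1 x = _ from extZero_pos _ ⟨x, h⟩, ← β.2.2]
    exact extZero_pos β.1 (posMap φ ⟨x, h⟩)

theorem translate_ne_zero (s : ZPow n φ l ⋊[precompHom n φ l] Zc φ) (p : Rtilde n) :
    ((p.1.1 + fun i => extZero (s.left.toAdd i).1 (s.right.1.1 p.1.2), s.right.1.1 p.1.2) :
      (Fin n → ℂ) × ℝ≥0) ≠ 0 := by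
  intro h
  have h2 : s.right.1.1 p.1.2 = 0 := congrArg Prod.snd h
  have h1 : p.1.1 + (fun i => extZero (s.left.toAdd i).1 (s.right.1.1 p.1.2)) = 0 :=
    congrArg Prod.fst h
  rw [h2] at h1
  simp only [extZero_zero] at h1
  refine p.2 (Prod.ext ((add_zero p.1.1).symm.trans h1) ?_)
  exact s.right.1.1.injective (h2.trans (map_zero_half _).symm)

/-- The action of `(𝒵_{φ,λ})ⁿ ⋊ Z_φ` on `ℂⁿ × [0,∞) \ {(O,0)}`. -/
def semidirectPerm (n : ℕ) (l : ℂˣ) (φ : DiffHalf) :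
    (ZPow n φ l ⋊[precompHom n φ l] Zc φ) →* Equiv.Perm (Rtilde n) :=
  MonoidHom.toHomPerm
    -- The translation is evaluated at $\eta(x)$ because $(\beta,\eta)$ acts by $\eta$ first and by
    -- $\beta$ afterwards.
    { toFun := fun s p => ⟨(p.1.1 + fun i => extZero (s.left.toAdd i).1 (s.right.1.1 p.1.2),
        s.right.1.1 p.1.2), translate_ne_zero s p⟩
      map_one' := by
        funext p
        refine Subtype.ext (Prod.ext ?_ rfl)
        show (p.1.1 + fun i => extZero (0 : ZSol φ l).1 p.1.2) = p.1.1
        funext i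
        simp [extZero]
      map_mul' := fun s t => by
        funext p
        refine Subtype.ext (Prod.ext ?_ rfl)
        funext i
        show p.1.1 i + extZero (((s * t).left.toAdd i)).1 (s.right.1.1 (t.right.1.1 p.1.2)) =
          p.1.1 i + extZero (t.left.toAdd i).1 (t.right.1.1 p.1.2) +
            extZero (s.left.toAdd i).1 (s.right.1.1 (t.right.1.1 p.1.2))
        have h1 : (s * t).left.toAdd i = s.left.toAdd i + precomp s.right⁻¹ (t.left.toAdd i) := rfl
        have h2 : ∀ (a b : PosHalf → ℂ) x, extZero (a + b) x = extZero a x + extZero b x := by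
          intro a b x
          unfold extZero
          split_ifs <;> simp
        have h3 : (s.right⁻¹ : Zc φ).1.1 (s.right.1.1 (t.right.1.1 p.1.2)) = t.right.1.1 p.1.2 :=
          s.right.1.1.symm_apply_apply _
        rw [h1, Submodule.coe_add, h2, extZero_precomp, h3]
        ring }

theorem semidirectPerm_apply (s : ZPow n φ l ⋊[precompHom n φ l] Zc φ) (p : Rtilde n) :
    (semidirectPerm n l φ s p).1 =
      (p.1.1 + fun i => extZero (s.left.toAdd i).1 (s.right.1.1 p.1.2), s.right.1.1 p.1.2) := rfl

theorem map_comm (η : Zc φ) (x : ℝ≥0) : η.1.1 (φ.1 x) = φ.1 (η.1.1 x) :=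
  congrArg (fun g : DiffHalf => g.1 x) (Subgroup.mem_centralizer_singleton_iff.mp η.2)

theorem semidirectPerm_mem_centralizer (s : ZPow n φ l ⋊[precompHom n φ l] Zc φ) :
    semidirectPerm n l φ s ∈ Subgroup.centralizer {T n l φ} := by
  rw [Subgroup.mem_centralizer_singleton_iff]
  refine Equiv.ext fun p => Subtype.ext (Prod.ext ?_ (map_comm s.right p.1.2))
  funext i
  show (l • p.1.1) i + extZero (s.left.toAdd i).1 (s.right.1.1 (φ.1 p.1.2)) =
    (l • (p.1.1 + fun i => extZero (s.left.toAdd i).1 (s.right.1.1 p.1.2))) i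
  rw [map_comm, extZero_map, smul_add]
  rfl

/-- The action of `(𝒵_{φ,λ})ⁿ ⋊ Z_φ` on `R`. -/
def semidirectQuot (n : ℕ) (l : ℂˣ) (φ : DiffHalf) :
    (ZPow n φ l ⋊[precompHom n φ l] Zc φ) →* Equiv.Perm (R n l φ) :=
  (quotientPerm (T n l φ)).comp
    ((semidirectPerm n l φ).codRestrict _ semidirectPerm_mem_centralizer)

section

variable (hl : 1 < ‖(l : ℂ)‖) (hφ : ∀ x : ℝ≥0, 0 < x → x < φ.1 x) (hφ0 : InfTangentToId φ)
include hl hφ hφ0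

theorem isLeafHolo_semidirectQuot (s : ZPow n φ l ⋊[precompHom n φ l] Zc φ) :
    IsLeafHolo (semidirectQuot n l φ s) := by
  refine isLeafHolo_quotientPerm _
    (M := fun y => y.1 + fun i => extZero (s.left.toAdd i).1 (onReal s.right.1.1 y.2).toNNReal)
    (η := s.right.1.1) s.right.1.2.1 ?_ ?_ (fun p => ?_)
  · have h1 : ContDiffOn ℝ ∞ (fun y : (Fin n → ℂ) × ℝ => onReal s.right.1.1 y.2)
        (Set.range (incl (n := n))) := by
      refine (contDiffOn_onReal s.right.1).comp contDiff_snd.contDiffOn ?_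
      rintro _ ⟨q, rfl⟩
      exact q.1.2.2
    exact contDiff_fst.contDiffOn.add (contDiffOn_pi.mpr fun i =>
      (contDiff_extZero hl hφ hφ0 (s.left.toAdd i)).comp_contDiffOn h1)
  · intro x
    refine Differentiable.add differentiable_id ?_
    exact differentiable_const fun i => extZero (s.left.toAdd i).1 (onReal s.right.1.1 x).toNNReal
  · refine (semidirectPerm_apply s p).trans ?_
    simp [incl, onReal]

theorem continuous_semidirectPerm (s : ZPow n φ l ⋊[precompHom n φ l] Zc φ) :
    Continuous (semidirectPerm n l φ s) := by
  have h1 : ∀ β : ZSol φ l, Continuous (extZero β.1) := fun β => by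
    refine ((contDiff_extZero hl hφ hφ0 β).continuous.comp NNReal.continuous_coe).congr fun x => ?_
    rw [Function.comp_apply, Real.toNNReal_coe]
  have h2 : Continuous fun p : Rtilde n => s.right.1.1 p.1.2 :=
    s.right.1.2.1.continuous.comp continuous_subtype_val.snd
  refine Continuous.subtype_mk ?_ _
  exact (continuous_subtype_val.fst.add (continuous_pi fun i => (h1 _).comp h2)).prodMk h2

/-- The homomorphism `(𝒵_{φ,λ})ⁿ ⋊ Z_φ → Aut R`. -/
def semidirectAutR : (ZPow n φ l ⋊[precompHom n φ l] Zc φ) →* AutR n l φ :=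
  (semidirectQuot n l φ).codRestrict (AutR n l φ) fun s =>
    show IsLeafHolo _ ∧ IsLeafHolo _ from ⟨isLeafHolo_semidirectQuot hl hφ hφ0 s, by
      rw [show (semidirectQuot n l φ s).symm = semidirectQuot n l φ s⁻¹ from
        (map_inv (semidirectQuot n l φ) s).symm]
      exact isLeafHolo_semidirectQuot hl hφ hφ0 s⁻¹⟩

/-- The homomorphism `(𝒵_{φ,λ})ⁿ ⋊ Z_φ → Aut(R,H)`. -/
def semidirectHom : (ZPow n φ l ⋊[precompHom n φ l] Zc φ) →* AutRH n l φ :=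
  (semidirectAutR hl hφ hφ0).codRestrict (AutRH n l φ) (by
    intro s h
    obtain ⟨z, rfl⟩ := Quotient.exists_rep h
    show (projR (semidirectPerm n l φ s (bdryTilde z)) : R n l φ) = projR (bdryTilde z)
    congr 1
    refine Subtype.ext ?_
    rw [semidirectPerm_apply]
    simp only [bdryTilde, map_zero_half, extZero_zero]
    exact Prod.ext (add_zero z.1) rfl)

theorem semidirectHom_apply (s : ZPow n φ l ⋊[precompHom n φ l] Zc φ) (p : Rtilde n) :
    (semidirectHom hl hφ hφ0 s).1.1 (projR p) = projR (semidirectPerm n l φ s p) := rfl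

/-- If the action on $R$ is trivial, the lift is some $T^k$. It fixes the boundary, so $k=0$ and the
lift is the identity; $\eta$ and $\beta$ are then read along a ray over $v\ne0$. -/
theorem injective_semidirectHom (hn : 1 ≤ n) :
    Function.Injective (semidirectHom (n := n) hl hφ hφ0) := by
  rw [injective_iff_map_eq_one]
  intro s hs
  have hT := isWandering_T (n := n) hl hφ
  obtain ⟨v, hv⟩ := (isConnected_compl_zero (n := n) hn 0).nonempty
  obtain ⟨k, hk⟩ := hT.exists_zpow_eq_of_lifts continuous_id
    (continuous_semidirectPerm hl hφ hφ0 s) (fun p => by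
      refine Eq.trans ?_ (semidirectHom_apply hl hφ hφ0 s p)
      rw [hs]
      rfl)
  have hk0 : k = 0 := by
    refine hT.zpow_eq_zero (x := bdryTilde ⟨v, hv⟩) ?_
    rw [show (T n l φ ^ k) (bdryTilde ⟨v, hv⟩) = _ from hk (bdryTilde ⟨v, hv⟩)]
    refine Subtype.ext ?_
    rw [semidirectPerm_apply]
    simp only [bdryTilde, map_zero_half, extZero_zero]
    exact Prod.ext (add_zero v) rfl
  subst hk0
  have hη : ∀ x : ℝ≥0, s.right.1.1 x = x := fun x => by
    have h1 := congrArg (fun p => p.1.2) (hk (toR (v, x)))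
    simp only [semidirectPerm_apply, toR_val (ne_zero_left hv x), zpow_zero, id,
      Equiv.Perm.one_apply] at h1
    exact h1.symm
  refine SemidirectProduct.ext ?_ (Subtype.ext (Subtype.ext (Equiv.ext hη)))
  apply Multiplicative.toAdd.injective
  funext i
  apply Subtype.ext
  funext x
  have h1 := congrArg (fun p => p.1.1 i) (hk (toR (v, x.1)))
  simp only [semidirectPerm_apply, toR_val (ne_zero_left hv x.1), zpow_zero, id, hη,
    Equiv.Perm.one_apply, Pi.add_apply, extZero_pos] at h1
  exact left_eq_add.mp h1

end

/-! ### Automorphisms that fix the boundary -/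

/-- On the connected boundary, any lift and the inclusion lift the same map, so they differ by one
power of $T$, which is absorbed into the lift. -/
theorem exists_lift_fixing (hn : 1 ≤ n) (hl : 1 < ‖(l : ℂ)‖)
    (hφ : ∀ x : ℝ≥0, 0 < x → x < φ.1 x) {f : R n l φ → R n l φ} (hf : IsLeafHolo f)
    (hb : ∀ h : H n l, f (bdry h) = bdry h) :
    ∃ F : Rtilde n → Rtilde n, IsLeafHoloLift F ∧ (∀ p, projR (F p) = f (projR p)) ∧
      ∀ z : Htilde n, F (bdryTilde z) = bdryTilde z := by
  have := connectedSpace_Htilde hn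
  have hT := isWandering_T (n := n) hl hφ
  obtain ⟨F, hF, hFf⟩ := hf.exists_lift hl hφ
  have hc : Continuous (bdryTilde (n := n)) := by
    refine Continuous.subtype_mk ?_ _
    exact continuous_subtype_val.prodMk continuous_const
  obtain ⟨k, hk⟩ := hT.exists_zpow_eq_of_lifts (hF.continuous.comp hc) hc
    (fun z => (hFf (bdryTilde z)).trans (hb (projH z)))
  refine ⟨fun p => (T n l φ ^ k) (F p), fun p => (hF p).zpow l φ k, fun p => ?_, hk⟩
  rw [← hFf]
  exact (projR_eq_iff.mpr ⟨k, rfl⟩).symm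

/-- The normalization on the boundary determines all exponents: the two normalized lifts are
mutually inverse, and the lift commutes with $T$ exactly. -/
theorem exists_perm_lift_fixing (hn : 1 ≤ n) (hl : 1 < ‖(l : ℂ)‖)
    (hφ : ∀ x : ℝ≥0, 0 < x → x < φ.1 x) (f : AutRH n l φ) :
    ∃ F : Equiv.Perm (Rtilde n), IsLeafHoloLift F ∧ IsLeafHoloLift F.symm ∧
      (∀ p, (projR (F p) : R n l φ) = f.1.1 (projR p)) ∧
      (∀ z : Htilde n, F (bdryTilde z) = bdryTilde z) ∧
      ∀ p, F (T n l φ p) = T n l φ (F p) := by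
  have hT := isWandering_T (n := n) hl hφ
  obtain ⟨z⟩ := (connectedSpace_Htilde hn).toNonempty
  obtain ⟨F, hF, hFf, hFb⟩ := exists_lift_fixing hn hl hφ f.1.2.1 f.2
  obtain ⟨E, hE, hEf, hEb⟩ := exists_lift_fixing hn hl hφ f.1.2.2 (f⁻¹).2
  obtain ⟨k, h1, h2⟩ := hT.exists_inverse_lift hF.continuous hE.continuous hFf hEf
  have hk : k = 0 := by
    refine hT.zpow_eq_zero (x := bdryTilde z) ?_
    have h3 := h1 (bdryTilde z)
    simp only [hFb, hEb] at h3
    exact h3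
  subst hk
  obtain ⟨m, hm⟩ := hT.exists_zpow_comp hF.continuous hFf
  have hm1 : m = 1 := by
    refine hT.zpow_injective (x := bdryTilde z) ?_
    have h3 := hm (bdryTilde z)
    have h4 := bdryTilde_zpow l φ 1 z
    rw [zpow_one, zpow_one] at h4
    rw [← h4, hFb, hFb, h4] at h3
    rw [← h3, zpow_one]
  subst hm1
  exact ⟨⟨F, E, h1, h2⟩, hF, hE, hFf, hFb, hm⟩

/-! ### Boundary-fixing lifts are translations along the leaves -/

section

variable {F : Rtilde n → Rtilde n} (hF : IsLeafHoloLift F)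

/-- Commutation with $T^k$ trades a dilation by $\lambda^k$ in the leaf for a move of the leaf
towards the boundary by $\varphi^{-k}$. -/
theorem apply_toR_smul (hT : ∀ p, F (T n l φ p) = T n l φ (F p)) (k : ℕ) (z : Fin n → ℂ) {y : ℝ≥0}
    (hy : 0 < y) :
    (F (toR (l ^ k • z, y))).1.1 = l ^ k • (F (toR (z, (φ⁻¹.1)^[k] y))).1.1 := by
  induction k generalizing y with
  | zero => simp
  | succ k ih =>
    have hy' : 0 < φ⁻¹.1 y := map_pos_half φ⁻¹ hy
    have h1 : toR (l ^ (k + 1) • z, y) = T n l φ (toR (l ^ k • z, φ⁻¹.1 y)) := by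
      refine Subtype.ext ?_
      rw [toR_val (ne_zero_right _ hy)]
      show _ = (l • (toR (l ^ k • z, φ⁻¹.1 y)).1.1, φ.1 (toR (l ^ k • z, φ⁻¹.1 y)).1.2)
      rw [toR_val (ne_zero_right _ hy'), pow_succ', mul_smul]
      exact Prod.ext rfl (φ.1.apply_symm_apply y).symm
    rw [h1, hT]
    show l • (F (toR (l ^ k • z, φ⁻¹.1 y))).1.1 = _
    rw [ih hy', pow_succ', mul_smul, Function.iterate_succ_apply]

include hF

theorem continuousAt_fst_toR {p : (Fin n → ℂ) × ℝ≥0} (hp : p ≠ 0) :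
    ContinuousAt (fun p => (F (toR p)).1.1) p :=
  (continuous_fst.comp continuous_subtype_val).continuousAt.comp
    (hF.continuous.continuousAt.comp (continuousAt_toR hp))

/-- A large $w$ is $\lambda^k$ times a point of the shell $1\le\|z\|\le|\lambda|$, with
$|\lambda|^k\le\|w\|$. By the scaling identity its value is $\lambda^k$ times a value of $F$ on the
product of the shell with $[0,x]$, a compact set that avoids $(O,0)$. -/
theorem exists_linear_growth (hl : 1 < ‖(l : ℂ)‖) (hφ : ∀ x : ℝ≥0, 0 < x → x < φ.1 x)
    (hT : ∀ p, F (T n l φ p) = T n l φ (F p)) {x : ℝ≥0} (hx : 0 < x) :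
    ∃ C, 0 ≤ C ∧ ∀ w, ‖(F (toR (w, x))).1.1‖ ≤ C * (1 + ‖w‖) := by
  set S : Set (Fin n → ℂ) := Metric.closedBall 0 ‖(l : ℂ)‖ ∩ (Metric.ball 0 1)ᶜ with hS
  have hSc : IsCompact S := (isCompact_closedBall _ _).inter_right Metric.isOpen_ball.isClosed_compl
  obtain ⟨A, hA⟩ := ((hSc.prod (isCompact_Icc (a := (0 : ℝ≥0)) (b := x))).image_of_continuousOn
    (f := fun p => (F (toR p)).1.1) (fun p hp => (continuousAt_fst_toR hF (by
      rintro rfl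
      exact hp.1.2 (by simp))).continuousWithinAt)).isBounded.exists_norm_le
  obtain ⟨B, hB⟩ := ((isCompact_closedBall (0 : Fin n → ℂ) 1).image
    (hF.differentiable hx).continuous).isBounded.exists_norm_le
  have hB0 : 0 ≤ B := (norm_nonneg _).trans (hB _ ⟨0, by simp, rfl⟩)
  refine ⟨max A B, hB0.trans (le_max_right _ _), fun w => ?_⟩
  have hC : 0 ≤ max A B := hB0.trans (le_max_right _ _)
  rcases le_or_gt ‖w‖ 1 with hw | hw
  · refine (hB _ ⟨w, by simpa using hw, rfl⟩).trans ((le_max_right A B).trans ?_)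
    exact le_mul_of_one_le_right hC (by linarith [norm_nonneg w])
  · obtain ⟨k, hk1, hk2⟩ := exists_nat_pow_near hw.le hl
    have hl0 : 0 < ‖(l : ℂ)‖ := one_pos.trans hl
    have hwk : w = l ^ k • ((l ^ k)⁻¹ • w) := (smul_inv_smul _ _).symm
    have hn : ‖(l ^ k)⁻¹ • w‖ = ‖w‖ / ‖(l : ℂ)‖ ^ k := by
      rw [norm_units_smul, Units.val_inv_eq_inv_val, Units.val_pow_eq_pow_val, norm_inv, norm_pow,
        inv_mul_eq_div]
    have h1 : ‖(F (toR ((l ^ k)⁻¹ • w, (φ⁻¹.1)^[k] x))).1.1‖ ≤ A := by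
      refine hA _ ⟨_, ⟨?_, zero_le, iterate_inv_le hφ k x⟩, rfl⟩
      rw [hS, Set.mem_inter_iff, mem_closedBall_zero_iff, Set.mem_compl_iff,
        mem_ball_zero_iff, not_lt, hn]
      constructor
      · rw [div_le_iff₀ (by positivity), ← pow_succ']
        exact hk2.le
      · rwa [le_div_iff₀ (by positivity), one_mul]
    rw [hwk, apply_toR_smul hT k _ hx, ← hwk, norm_units_smul, Units.val_pow_eq_pow_val, norm_pow,
      mul_comm]
    exact mul_le_mul (h1.trans (le_max_left _ _)) (by linarith) (by positivity) hC

/-- Linear growth makes $F$ affine along $t\mapsto tw$, with slope $c$. Scaling gives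
$f(w,\varphi^{-k}(x))=\lambda^{-k}f(0,x)+c$ for the leaf coordinate $f$ of $F$. As $k\to\infty$ the
left side tends to the boundary value $f(w,0)=w$, so $c=w$. -/
theorem fst_apply_toR (hl : 1 < ‖(l : ℂ)‖) (hφ : ∀ x : ℝ≥0, 0 < x → x < φ.1 x)
    (hT : ∀ p, F (T n l φ p) = T n l φ (F p)) (hb : ∀ z : Htilde n, F (bdryTilde z) = bdryTilde z)
    {x : ℝ≥0} (hx : 0 < x) (w : Fin n → ℂ) :
    (F (toR (w, x))).1.1 = w + (F (toR (0, x))).1.1 := by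
  by_cases hw : w = 0
  · rw [hw, zero_add]
  obtain ⟨C, hC0, hC⟩ := exists_linear_growth hF hl hφ hT hx
  have hline : Differentiable ℂ fun t : ℂ => t • w := by fun_prop
  obtain ⟨c, hc⟩ := exists_affine_of_norm_le
    (f := fun t : ℂ => (F (toR (t • w, x))).1.1) ((hF.differentiable hx).comp hline)
    (C := C * (1 + ‖w‖)) (fun t => by
      refine (hC _).trans ?_
      rw [mul_assoc, norm_smul]
      refine mul_le_mul_of_nonneg_left ?_ hC0
      nlinarith [norm_nonneg t, norm_nonneg w])
  simp only [zero_smul] at hc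
  have h1 : Filter.Tendsto (fun k : ℕ => (F (toR (w, (φ⁻¹.1)^[k] x))).1.1) Filter.atTop (𝓝 w) := by
    have h2 : (F (toR (w, 0))).1.1 = w := by
      have h3 : toR (w, 0) = bdryTilde ⟨w, hw⟩ := Subtype.ext (toR_val (ne_zero_left hw 0))
      rw [h3, hb]
      rfl
    have h3 : Filter.Tendsto (fun k : ℕ => ((w, (φ⁻¹.1)^[k] x) : (Fin n → ℂ) × ℝ≥0)) Filter.atTop
        (𝓝 (w, 0)) := tendsto_const_nhds.prodMk_nhds (tendsto_iterate_inv hφ x)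
    have h4 := (continuousAt_fst_toR hF (ne_zero_left hw 0)).tendsto.comp h3
    rwa [h2] at h4
  have h2 : Filter.Tendsto (fun k : ℕ => l⁻¹ ^ k • (F (toR (0, x))).1.1 + c) Filter.atTop
      (𝓝 c) := by
    simpa using (tendsto_inv_pow_smul hl ((F (toR (0, x))).1.1)).add_const c
  have h3 : w = c := by
    refine tendsto_nhds_unique h1 (h2.congr fun k => ?_)
    have h5 := hc ((l : ℂ) ^ k)
    have h6 : ∀ v : Fin n → ℂ, (l : ℂ) ^ k • v = l ^ k • v := fun v => by
      rw [Units.smul_def, Units.val_pow_eq_pow_val]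
    rw [h6, h6, apply_toR_smul hT k w hx] at h5
    have h7 := congrArg (fun v => l⁻¹ ^ k • v) h5
    simp only [smul_add, smul_smul, ← mul_pow, inv_mul_cancel, one_pow, one_smul] at h7
    exact h7.symm
  have h4 := hc 1
  rw [one_smul, one_smul, ← h3] at h4
  rw [h4, add_comm]

end

theorem exists_transverse_map (hn : 1 ≤ n) {F : Rtilde n → Rtilde n} (hF : IsLeafHoloLift F) :
    ∃ η : ℝ≥0 → ℝ≥0, SmoothHalf η ∧ ∀ p, (F p).1.2 = η p.1.2 := by
  obtain ⟨v, hv⟩ := (isConnected_compl_zero (n := n) hn 0).nonempty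
  refine ⟨fun x => (F (toR (v, x))).1.2, (hF.contDiffOn_slice hv).snd, fun p => ?_⟩
  refine hF.snd_eq_of_snd_eq hn ?_
  rw [toR_val (ne_zero_left hv _)]

theorem surjective_semidirectHom (hn : 1 ≤ n) (hl : 1 < ‖(l : ℂ)‖)
    (hφ : ∀ x : ℝ≥0, 0 < x → x < φ.1 x) (hφ0 : InfTangentToId φ) :
    Function.Surjective (semidirectHom (n := n) hl hφ hφ0) := by
  intro f
  obtain ⟨v, hv⟩ := (isConnected_compl_zero (n := n) hn 0).nonempty
  obtain ⟨F, hF, hF', hFf, hFb, hFT⟩ := exists_perm_lift_fixing hn hl hφ f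
  obtain ⟨η, hη, hFη⟩ := exists_transverse_map hn hF
  obtain ⟨ζ, hζ, hFζ⟩ := exists_transverse_map hn hF'
  have hval : ∀ x, (toR (v, x)).1.2 = x := fun x => by rw [toR_val (ne_zero_left hv x)]
  have h1 : ∀ x, ζ (η x) = x := fun x => by
    have := hFζ (F (toR (v, x)))
    rw [Equiv.symm_apply_apply, hFη, hval] at this
    exact this.symm
  have h2 : ∀ x, η (ζ x) = x := fun x => by
    have := hFη (F.symm (toR (v, x)))
    rw [Equiv.apply_symm_apply, hFζ, hval] at this
    exact this.symm
  set η' : DiffHalf := ⟨⟨η, ζ, h1, h2⟩, hη, hζ⟩ with hη'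
  have hcomm : η' ∈ Zc φ := by
    rw [Subgroup.mem_centralizer_singleton_iff]
    refine Subtype.ext (Equiv.ext fun x => ?_)
    show η (φ.1 x) = φ.1 (η x)
    have h3 := congrArg (fun p => p.1.2) (hFT (toR (v, x)))
    have h4 : (T n l φ (F (toR (v, x)))).1.2 = φ.1 (F (toR (v, x))).1.2 := rfl
    have h5 : (T n l φ (toR (v, x))).1.2 = φ.1 (toR (v, x)).1.2 := rfl
    simp only [h4, hFη, h5, hval] at h3
    exact h3
  have hcomm' : ∀ x, ζ (φ.1 x) = φ.1 (ζ x) := map_comm (⟨η', hcomm⟩⁻¹ : Zc φ)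
  have hζpos : ∀ x, 0 < x → 0 < ζ x := fun x hx => map_pos_half η'⁻¹ hx
  -- The argument `ζ x` appears because the semidirect product evaluates $\beta$ after $\eta$, and
  -- `ζ` inverts `η`.
  let b : ℝ≥0 → Fin n → ℂ := fun x => (F (toR (0, ζ x))).1.1
  let β : Fin n → ZSol φ l := fun i => ⟨fun x => b x.1 i, by
    constructor
    -- Smoothness in $x$ is available along rays over $v\ne0$, so $f(0,\cdot)$ is rewritten as
    -- $f(v,\cdot)-v$.
    · have h3 : ContDiffOn ℝ ∞ (fun x : ℝ => (incl (F (toR (v, (onReal ζ x).toNNReal)))).1 i - v i)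
          (Set.Ioi 0) := by
        refine ContDiffOn.sub ?_ contDiffOn_const
        refine (contDiffOn_pi.mp (ContDiffOn.comp (hF.contDiffOn_slice hv).fst
          ((contDiffOn_onReal η'⁻¹).mono Set.Ioi_subset_Ici_self) ?_)) i
        exact fun x hx => (onReal_pos η'⁻¹ hx).le
      refine h3.congr fun x hx => ?_
      have hx' : 0 < x.toNNReal := by simpa using hx
      have h4 := fst_apply_toR hF hl hφ hFT hFb (hζpos _ hx') v
      rw [show extZero _ x.toNNReal = _ from extZero_pos _ ⟨_, hx'⟩]
      simp only [incl, onReal, Real.toNNReal_coe, h4, b, Pi.add_apply, add_sub_cancel_left]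
    · intro x
      show b (φ.1 x.1) i = l * b x.1 i
      -- The functional equation for $\beta$ is the scaling identity at $z=0$ with $k=1$.
      have h3 := apply_toR_smul hFT 1 (0 : Fin n → ℂ) (map_pos_half φ (hζpos _ x.2))
      rw [smul_zero, pow_one, Function.iterate_one,
        show φ⁻¹.1 (φ.1 (ζ x.1)) = ζ x.1 from φ.1.symm_apply_apply _] at h3
      simp only [b, hcomm', h3]
      rfl⟩
  refine ⟨⟨Multiplicative.ofAdd β, ⟨η', hcomm⟩⟩, ?_⟩
  apply Subtype.ext
  apply Subtype.ext
  refine Equiv.ext fun y => ?_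
  obtain ⟨p, rfl⟩ := Quotient.exists_rep y
  refine Eq.trans ?_ (hFf p)
  refine (semidirectHom_apply hl hφ hφ0 _ p).trans ?_
  congr 1
  refine Subtype.ext ?_
  rw [semidirectPerm_apply]
  show (p.1.1 + fun i => extZero (β i).1 (η p.1.2), η p.1.2) = (F p).1
  refine Prod.ext ?_ (hFη p).symm
  rcases eq_or_lt_of_le (zero_le (a := p.1.2)) with hx | hx
  · obtain ⟨z, hz⟩ := exists_eq_bdryTilde hx.symm
    have h3 : η 0 = 0 := map_zero_half η'
    rw [← hz, hFb]
    simp only [bdryTilde, h3, extZero_zero]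
    exact add_zero z.1
  · have h3 := fst_apply_toR hF hl hφ hFT hFb hx p.1.1
    rw [show toR (p.1.1, p.1.2) = p from toR_coe p] at h3
    refine Eq.trans ?_ h3.symm
    show (p.1.1 + fun i => extZero (β i).1 (η p.1.2)) = _
    congr 1
    funext i
    have hpos : 0 < η p.1.2 := map_pos_half η' hx
    rw [show extZero (β i).1 (η p.1.2) = _ from extZero_pos _ ⟨_, hpos⟩]
    simp only [β, b, h1]

/-- The isomorphism `(𝒵_{φ,λ})ⁿ ⋊ Z_φ ≅ Aut(R,H)`. -/
def semidirectEquiv (hn : 1 ≤ n) (hl : 1 < ‖(l : ℂ)‖)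
    (hφ : ∀ x : ℝ≥0, 0 < x → x < φ.1 x) (hφ0 : InfTangentToId φ) :
    (ZPow n φ l ⋊[precompHom n φ l] Zc φ) ≃* AutRH n l φ :=
  MulEquiv.ofBijective (semidirectHom hl hφ hφ0)
    ⟨injective_semidirectHom hl hφ hφ0 hn, surjective_semidirectHom hn hl hφ hφ0⟩

theorem semidirectEquiv_apply (hn : 1 ≤ n) (hl : 1 < ‖(l : ℂ)‖)
    (hφ : ∀ x : ℝ≥0, 0 < x → x < φ.1 x) (hφ0 : InfTangentToId φ)
    (s : ZPow n φ l ⋊[precompHom n φ l] Zc φ) (p : Rtilde n) :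
    (semidirectEquiv hn hl hφ hφ0 s).1.1 (projR p) = projR (semidirectPerm n l φ s p) := rfl

end

end LCReeb

theorem mainTheorem8 (n : ℕ) (hn : 1 ≤ n) (l : ℂˣ) (hl : 1 < ‖(l : ℂ)‖)
    (φ : LCReeb.DiffHalf) (hφ : ∀ x : ℝ≥0, 0 < x → x < φ.1 x)
    (hφ0 : LCReeb.InfTangentToId φ) :
    -- the restriction map `r : Aut R → Aut H`, with kernel `Aut(R,H)`
    (∃ r : LCReeb.AutR n l φ →* LCReeb.AutH n l,
      (∀ (f : LCReeb.AutR n l φ) (h : LCReeb.H n l),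
        LCReeb.bdry ((r f).1 h) = f.1 (LCReeb.bdry h)) ∧
      r.ker = LCReeb.AutRH n l φ ∧
      (2 ≤ n → Function.Surjective r)) ∧
    -- `GL(n,ℂ) / ⟨λ Iₙ⟩ ≅ Aut H`, by the linear action
    (2 ≤ n → ∃ e : (GL (Fin n) ℂ ⧸ LCReeb.scalarPowers n l) ≃* LCReeb.AutH n l,
      ∀ (A : GL (Fin n) ℂ) (z : LCReeb.Htilde n), ∃ w : LCReeb.Htilde n,
        w.1 = (A : Matrix (Fin n) (Fin n) ℂ) *ᵥ z.1 ∧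
        (e (QuotientGroup.mk A)).1 (LCReeb.projH z) = LCReeb.projH w) ∧
    -- `(𝒵_{φ,λ})ⁿ ⋊ Z_φ ≅ Aut(R,H)`: `β` acts by `[z,x] ↦ [z + β(x), x]` (where `β(0) = 0`)
    -- and `η` acts by `[z,x] ↦ [z, η(x)]`
    (∃ e : (LCReeb.ZPow n φ l ⋊[LCReeb.precompHom n φ l] LCReeb.Zc φ) ≃* LCReeb.AutRH n l φ,
      (∀ (β : Fin n → LCReeb.ZSol φ l) (p : LCReeb.Rtilde n), ∃ q : LCReeb.Rtilde n,
        q.1 = (p.1.1 + fun i => LCReeb.extZero (β i).1 p.1.2, p.1.2) ∧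
        (e (SemidirectProduct.inl (Multiplicative.ofAdd β))).1.1 (LCReeb.projR p)
          = LCReeb.projR q) ∧
      (∀ (η : LCReeb.Zc φ) (p : LCReeb.Rtilde n), ∃ q : LCReeb.Rtilde n,
        q.1 = (p.1.1, η.1.1 p.1.2) ∧
        (e (SemidirectProduct.inr η)).1.1 (LCReeb.projR p) = LCReeb.projR q)) := by
  refine ⟨⟨LCReeb.restrictHom hn hl hφ, LCReeb.bdry_restrictPerm hn hl hφ,
    LCReeb.ker_restrictHom hn hl hφ, fun h2 => LCReeb.surjective_restrictHom h2 hl hφ⟩,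
    fun h2 => ⟨LCReeb.glEquivAutH h2 hl, fun A z => ⟨LCReeb.glPermH n A z, rfl, ?_⟩⟩,
    LCReeb.semidirectEquiv hn hl hφ hφ0,
    fun β p => ⟨LCReeb.semidirectPerm n l φ _ p, rfl,
      LCReeb.semidirectEquiv_apply hn hl hφ hφ0 _ p⟩,
    fun η p => ⟨LCReeb.semidirectPerm n l φ (SemidirectProduct.inr η) p, ?_,
      LCReeb.semidirectEquiv_apply hn hl hφ hφ0 _ p⟩⟩
  · rw [LCReeb.glEquivAutH_mk]
    rfl
  · rw [LCReeb.semidirectPerm_apply]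
    refine Prod.ext ?_ rfl
    funext i
    show p.1.1 i + LCReeb.extZero (0 : LCReeb.ZSol φ l).1 _ = p.1.1 i
    rw [add_eq_left]
    unfold LCReeb.extZero
    split_ifs <;> rfl
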